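/- \textbf{Setting.} Let $L\subseteq\{0,1\}^*$ be a regular language and $N\ge 2$. If $L\cap\{0,1\}^N\neq\emptyset$, the $N$-qubit regular language state (RLS) of $L$ is $|L_N\rangle=|L\cap\{0,1\}^N|^{-1/2}\sum_{w\in L\cap\{0,1\}^N}|w\rangle$; the complement RLS is the RLS of $\bar L=\{0,1\}^*\setminus L$. For $1\le n\le N-1$ let $\chi_n$ be the rank of the $2^n\times 2^{N-n}$ matrix obtained by reshaping the amplitudes of $|L_N\rangle$ between the first $n$ and the last $N-n$ qubits, and let $\chi=\max_n\chi_n$ be the maximal Schmidt rank of $|L_N\rangle$. A circuit on $N$ qubits is a finite sequence of elementary gates, each an arbitrary one-qubit unitary or a CNOT between an arbitrary pair of distinct qubits (all-to-all connectivity). Its gate count is the number of these gates, and its depth is the length of a critical path. It prepares $|\psi\rangle$ if it maps $|0^N\rangle$ to $|\psi\rangle$ up to a global phase. \textbf{The tree-based pipeline} for a target language $T$ consists of the following steps. \begin{enumerate} \item Take the matrix product state (MPS) of a minimal partial DFA for $T$ (tensors $A^x_{ij}=1$ if $\delta(i,x)=j$ and $0$ otherwise, with boundary vectors given by the initial state and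 the accepting states), or that of a minimal layered (acyclic) DFA for $T\cap\{0,1\}^N$, with $N+1$ layers and a single initial and a single accepting state. \item Bring the MPS to canonical form by a right-to-left and then a left-to-right sweep of compact singular value decompositions (SVDs, with zero singular values discarded), the state being normalized at the end. \item Repeat layer by layer, until two tensors are left: merge neighbouring tensors in pairs (an unpaired last tensor is passed on), reshape each merged tensor to a matrix $M$ from its two horizontal legs to its two vertical legs, take a compact SVD $M=U\,\mathrm{diag}(s)\,V^\dagger$, keep $U$ as a node of a binary tree, and keep $\mathrm{diag}(s)V^\dagger$ as a tensor of the next layer. The merge of the last two tensors is the top of the tree. \item Pad each leg of the tree, of dimension $d$, to $\lceil\log_2 d\rceil$ qubits and each node to an isometry from $m$ to $n\ge m$ qubits, where $n$ is the total number of qubits of its two upper legs. The node acts on the qubits of its upper legs: the first $m$ of them carry the lower leg, the others are still in $|0\rangle$. \item Compile each padded isometry by an isometry synthesis method, that is, a method that turns every isometry $V$ from $m$ to $n$ qubits into a circuit on $n$ qubits that maps $|\alpha\rangle|0^{n-m}\rangle$ to $V|\alpha\rangle$ for all $\alpha\in\{0,1\}^m$, up to one global phase. The output circuit is the composition of the circuits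 of all nodes, from the top of the tree to the leaves. \end{enumerate} \textbf{Theorem (TreeRLSP resources).} There are an isometry synthesis method that uses $O(2^{m+n})$ elementary gates for every isometry from $m$ to $n$ qubits and an absolute constant $K$ such that, for this method, the following holds. Let $N\ge 2$, let $L$ be a regular language with $L\cap\{0,1\}^N\ne\emptyset$, let $\chi$ be the maximal Schmidt rank of $|L_N\rangle$, and let $T=L$ or $T=\bar L$ with $T\cap\{0,1\}^N\neq\emptyset$. Then, with either kind of automaton in step 1, the pipeline for $T$ can be run to the end, and for every run (that is, for every choice of the minimal automaton, of the SVDs and of the paddings): \begin{enumerate} \item all tensors of the tree are isometries, and the tree contracts to the state $|T_N\rangle$; \item the output is a circuit on exactly $N$ qubits (no ancillae), with all-to-all connectivity, that prepares $|T_N\rangle$; \item its depth is at most $K\chi^6\log N$, and it has at most $K\chi^6N$ elementary gates. \end{enumerate} -/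

import Mathlib

open scoped Matrix

namespace TreeRLSP

/-! ## States, regular language states, Schmidt ranks -/

/-- Vectors of `(ℂ²)^{⊗ N}`, given by their amplitudes on the computational basis `{0,1}^N`. -/
abbrev State (N : ℕ) : Type := (Fin N → Fin 2) → ℂ

/-- The computational basis vector `|y⟩`. -/
def basisState {N : ℕ} (y : Fin N → Fin 2) : State N := fun x => if x = y then 1 else 0

/-- The words of length `N` of a language `L`, as bit strings. -/
def slice (L : Language (Fin 2)) (N : ℕ) : Set (Fin N → Fin 2) := {x | List.ofFn x ∈ L}

open Classical in
/-- The regular language state `|L_N⟩`: the uniform superposition of the length-`N` words of `L`. -/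
noncomputable def rls (L : Language (Fin 2)) (N : ℕ) : State N :=
  fun x => if x ∈ slice L N then ((1 / Real.sqrt ((slice L N).ncard : ℝ) : ℝ) : ℂ) else 0

/-- The amplitudes of `ψ` reshaped into a `2^n × 2^(N-n)` matrix across the cut `n`. -/
def cutMatrix {N : ℕ} (ψ : State N) (n : ℕ) :
    Matrix (Fin n → Fin 2) (Fin (N - n) → Fin 2) ℂ :=
  Matrix.of fun a b => ψ fun i => if h : i.val < n then a ⟨i.val, h⟩ else b ⟨i.val - n, by omega⟩

/-- Schmidt rank across the cut `{1,…,n} | {n+1,…,N}`. -/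
noncomputable def schmidtRank {N : ℕ} (ψ : State N) (n : ℕ) : ℕ := (cutMatrix ψ n).rank

/-- Maximal Schmidt rank over the cuts `n ∈ {1,…,N-1}`. -/
noncomputable def maxSchmidtRank {N : ℕ} (ψ : State N) : ℕ :=
  (Finset.Icc 1 (N - 1)).sup (schmidtRank ψ)

/-! ## Circuits with all-to-all connectivity -/

/-- Elementary gates on `N` qubits: arbitrary one-qubit unitaries, and CNOT gates between an
arbitrary pair of distinct qubits (all-to-all connectivity). -/
inductive Gate (N : ℕ) : Type
  | one (q : Fin N) (u : Matrix.unitaryGroup (Fin 2) ℂ) : Gate N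
  | cnot (c t : Fin N) (h : c ≠ t) : Gate N

namespace Gate

/-- The action of a gate on a state. -/
def apply {N : ℕ} : Gate N → State N → State N
  | one q u, ψ => fun x => ∑ b : Fin 2, (u : Matrix (Fin 2) (Fin 2) ℂ) (x q) b *
      ψ (Function.update x q b)
  | cnot c t _, ψ => fun x => ψ (Function.update x t (x t + x c))

/-- The qubits a gate acts on. -/
def wires {N : ℕ} : Gate N → Finset (Fin N)
  | one q _ => {q}
  | cnot c t _ => {c, t}

/-- Placing a gate on other wires. -/
def map {n N : ℕ} (e : Fin n ↪ Fin N) : Gate n → Gate N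
  | one q u => one (e q) u
  | cnot c t h => cnot (e c) (e t) (fun h' => h (e.injective h'))

end Gate

/-- A circuit on exactly `N` qubits (so without ancillae): a list of elementary gates, the head
being applied first.  Its total gate count is the length of the list. -/
abbrev Circuit (N : ℕ) : Type := List (Gate N)

namespace Circuit

/-- The action of a circuit on a state. -/
def run {N : ℕ} (c : Circuit N) (ψ : State N) : State N := c.foldl (fun φ g => g.apply φ) ψ

/-- One step of the scheduling that defines the depth: a gate starts as soon as all its wires are
free, and takes one unit of time. -/
def tick {N : ℕ} (τ : Fin N → ℕ) (g : Gate N) : Fin N → ℕ :=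
  fun q => if q ∈ g.wires then g.wires.sup τ + 1 else τ q

/-- Circuit depth: the length of a critical path. -/
def depth {N : ℕ} (c : Circuit N) : ℕ := Finset.univ.sup (c.foldl tick fun _ => 0)

/-- `c` maps `|0…0⟩` to `ψ`, up to a global phase. -/
def Prepares {N : ℕ} (c : Circuit N) (ψ : State N) : Prop :=
  ∃ z : ℂ, ‖z‖ = 1 ∧ c.run (basisState fun _ => 0) = z • ψ

end Circuit

/-! ## Matrix product states -/

/-- Chains of `N` qubit tensors with left-most bond dimension `a` and right-most one `b`.
An MPS with open boundary conditions on `N` qubits is an element of `MPS N 1 1`. -/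
inductive MPS : ℕ → ℕ → ℕ → Type
  | nil (a : ℕ) : MPS 0 a a
  | cons {N a m b : ℕ} (A : Fin 2 → Matrix (Fin a) (Fin m) ℂ) (rest : MPS N m b) :
      MPS (N + 1) a b

/-- The contraction `A_[1]^{x_1} ⋯ A_[N]^{x_N}`. -/
noncomputable def MPS.eval : {N a b : ℕ} → MPS N a b → (Fin N → Fin 2) → Matrix (Fin a) (Fin b) ℂ
  | _, _, _, .nil _, _ => 1
  | _, _, _, .cons A rest, x => A (x 0) * rest.eval (Fin.tail x)

/-! ## Automata and their MPS -/

/-- A deterministic finite automaton with `D` states over `{0,1}`, whose transition function may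
be undefined (`none`). -/
structure PDFA (D : ℕ) where
  step : Fin D → Fin 2 → Option (Fin D)
  start : Fin D
  accept : Finset (Fin D)

namespace PDFA

/-- The accepted language: words with a run from the initial state to an accepting state. -/
def accepts {D : ℕ} (M : PDFA D) : Language (Fin 2) :=
  {w | ∃ q ∈ M.accept, w.foldlM M.step M.start = some q}

/-- `M` is a minimal automaton for `L`. -/
def IsMinimalFor {D : ℕ} (M : PDFA D) (L : Language (Fin 2)) : Prop :=
  M.accepts = L ∧ ∀ (D' : ℕ) (M' : PDFA D'), M'.accepts = L → D ≤ D'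

/-- The adjacency matrix of the edges labelled by `x`. -/
def adj {D : ℕ} (M : PDFA D) (x : Fin 2) : Matrix (Fin D) (Fin D) ℂ :=
  Matrix.of fun i j => if M.step i x = some j then 1 else 0

/-- Left boundary vector. -/
def left {D : ℕ} (M : PDFA D) : Matrix (Fin 1) (Fin D) ℂ :=
  Matrix.of fun _ i => if i = M.start then 1 else 0

/-- Right boundary vector. -/
def right {D : ℕ} (M : PDFA D) : Matrix (Fin D) (Fin 1) ℂ :=
  Matrix.of fun i _ => if i ∈ M.accept then 1 else 0

/-- `n` bulk tensors followed by the last tensor. -/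
noncomputable def bulk {D : ℕ} (M : PDFA D) : (n : ℕ) → MPS (n + 1) D 1
  | 0 => .cons (fun x => M.adj x * M.right) (.nil 1)
  | n + 1 => .cons M.adj (M.bulk n)

/-- The uniform-bulk MPS of an automaton on `N` qubits (the value for `N = 0` is immaterial). -/
noncomputable def toMPS {D : ℕ} (M : PDFA D) : (N : ℕ) → MPS N 1 1
  | 0 => .nil 1
  | 1 => .cons (fun x => M.left * M.adj x * M.right) (.nil 1)
  | n + 2 => .cons (fun x => M.left * M.adj x) (M.bulk n)

end PDFA

/-- Layered (directed acyclic) automata with `N + 1` layers of states, the first of size `a` and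
the last of size `b`, and partial transitions between consecutive layers.  A DAG-DFA, with one
initial and one accepting state, is an element of `DagDFA N 1 1`. -/
inductive DagDFA : ℕ → ℕ → ℕ → Type
  | nil (a : ℕ) : DagDFA 0 a a
  | cons {N a m b : ℕ} (δ : Fin a → Fin 2 → Option (Fin m)) (rest : DagDFA N m b) :
      DagDFA (N + 1) a b

namespace DagDFA

/-- The state of the last layer reached from `q` on reading `x`, if any. -/
def eval : {N a b : ℕ} → DagDFA N a b → Fin a → (Fin N → Fin 2) → Option (Fin b)
  | _, _, _, .nil _, q, _ => some q
  | _, _, _, .cons δ rest, q, x => (δ q (x 0)).bind fun q' => rest.eval q' (Fin.tail x)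

/-- Total number of states. -/
def numStates : {N a b : ℕ} → DagDFA N a b → ℕ
  | _, _, _, .nil a => a
  | _, a, _, .cons _ rest => a + rest.numStates

/-- The words accepted by a DAG-DFA. -/
def accepts {N : ℕ} (M : DagDFA N 1 1) : Set (Fin N → Fin 2) := {x | M.eval 0 x = some 0}

/-- `M` is a minimal DAG-DFA for the length-`N` words of `L`. -/
def IsMinimalFor {N : ℕ} (M : DagDFA N 1 1) (L : Language (Fin 2)) : Prop :=
  M.accepts = slice L N ∧
    ∀ M' : DagDFA N 1 1, M'.accepts = slice L N → M.numStates ≤ M'.numStates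

/-- The non-uniform MPS of a layered automaton. -/
noncomputable def toMPS : {N a b : ℕ} → DagDFA N a b → MPS N a b
  | _, _, _, .nil a => .nil a
  | _, _, _, .cons δ rest =>
      .cons (fun x => Matrix.of fun i j => if δ i x = some j then 1 else 0) rest.toMPS

end DagDFA

/-- The two automaton representations: a DFA (for a regular expression or a DFA as input), or a
DAG-DFA (for a set of strings of length `N` as input). -/
inductive Route : Type
  | dfa
  | dag

/-- The MPS produced by the frontend for the target language `L`: the MPS of a minimal DFA, or of
a minimal DAG-DFA, for `L`. -/
inductive FrontEnd (L : Language (Fin 2)) (N : ℕ) : Route → MPS N 1 1 → Prop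
  | dfa {D : ℕ} (M : PDFA D) (hM : M.IsMinimalFor L) : FrontEnd L N .dfa (M.toMPS N)
  | dag (M : DagDFA N 1 1) (hM : M.IsMinimalFor L) : FrontEnd L N .dag M.toMPS

/-! ## Sequential SVD pass: MPS to canonical MPS -/

/-- Compact singular value decomposition `M = U diag(s) Vᴴ` (vanishing singular values are
discarded, so that `r` is the rank of `M`). -/
structure IsCompactSVD {ι κ : Type} [Fintype ι] [Fintype κ] {r : ℕ} (M : Matrix ι κ ℂ)
    (U : Matrix ι (Fin r) ℂ) (s : Fin r → ℝ) (V : Matrix κ (Fin r) ℂ) : Prop where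
  isometry_left : Uᴴ * U = 1
  isometry_right : Vᴴ * V = 1
  pos : ∀ k, 0 < s k
  eq : M = U * Matrix.diagonal (fun k => (s k : ℂ)) * Vᴴ

/-- Right-to-left sweep: `RightSweep M C M'` says that sweeping through the chain `M` leaves the
chain `M'` of right isometric tensors and the matrix `C = U diag(s)` to be absorbed on its left. -/
inductive RightSweep : {N a a' b : ℕ} → MPS N a b → Matrix (Fin a) (Fin a') ℂ → MPS N a' b → Prop
  | nil (a : ℕ) : RightSweep (.nil a) (1 : Matrix (Fin a) (Fin a) ℂ) (.nil a)
  | cons {N a m m' b r : ℕ} (A : Fin 2 → Matrix (Fin a) (Fin m) ℂ) {rest : MPS N m b}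
      {C : Matrix (Fin m) (Fin m') ℂ} {rest' : MPS N m' b}
      (U : Matrix (Fin a) (Fin r) ℂ) (s : Fin r → ℝ) (V : Matrix (Fin 2 × Fin m') (Fin r) ℂ)
      (hrest : RightSweep rest C rest')
      (hsvd : IsCompactSVD (Matrix.of fun i (p : Fin 2 × Fin m') => (A p.1 * C) i p.2) U s V) :
      RightSweep (.cons A rest) (U * Matrix.diagonal (fun k => (s k : ℂ)))
        (.cons (fun x => Matrix.of fun k j => Vᴴ k (x, j)) rest')

/-- Left-to-right sweep: `LeftSweep C M M'` says that `M'` is the chain of left isometric tensors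
obtained from `M` after absorbing the matrix `C` on its left.  The last tensor, a single column, is
normalized. -/
inductive LeftSweep : {N a' a : ℕ} → Matrix (Fin a') (Fin a) ℂ → MPS N a 1 → MPS N a' 1 → Prop
  | last {a' a : ℕ} (C : Matrix (Fin a') (Fin a) ℂ) (A : Fin 2 → Matrix (Fin a) (Fin 1) ℂ) :
      LeftSweep C (.cons A (.nil 1))
        (.cons (fun x =>
          (((Real.sqrt (∑ y, ∑ i, ‖(C * A y) i 0‖ ^ 2))⁻¹ : ℝ) : ℂ) • (C * A x)) (.nil 1))
  | step {N a' a m r : ℕ} (C : Matrix (Fin a') (Fin a) ℂ) (A : Fin 2 → Matrix (Fin a) (Fin m) ℂ)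
      {rest : MPS (N + 1) m 1} {rest' : MPS (N + 1) r 1}
      (U : Matrix (Fin a' × Fin 2) (Fin r) ℂ) (s : Fin r → ℝ) (V : Matrix (Fin m) (Fin r) ℂ)
      (hsvd : IsCompactSVD (Matrix.of fun (p : Fin a' × Fin 2) j => (C * A p.2) p.1 j) U s V)
      (hrest : LeftSweep (Matrix.diagonal (fun k => (s k : ℂ)) * Vᴴ) rest rest') :
      LeftSweep C (.cons A rest) (.cons (fun x => Matrix.of fun i k => U (i, x) k) rest')

/-- The double sweep, first from right to left, then from left to right. -/
inductive SeqSVD : {N : ℕ} → MPS N 1 1 → MPS N 1 1 → Prop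
  | mk {N m m' : ℕ} (A : Fin 2 → Matrix (Fin 1) (Fin m) ℂ) {rest : MPS N m 1}
      {C : Matrix (Fin m) (Fin m') ℂ} {rest' : MPS N m' 1} {M' : MPS (N + 1) 1 1}
      (hR : RightSweep rest C rest')
      (hL : LeftSweep 1 (.cons (fun x => A x * C) rest') M') :
      SeqSVD (.cons A rest) M'

/-! ## Tree-based SVD pass: canonical MPS to a tree of isometries -/

/-- Binary tree tensor networks on `N` qubits: leaves carry a qubit, and `IsoTree N d` is the type
of trees whose root has an open lower leg of dimension `d`. -/
inductive IsoTree (N : ℕ) : ℕ → Type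
  | leaf (q : Fin N) : IsoTree N 2
  | node {d₁ d₂ d : ℕ} (l : IsoTree N d₁) (r : IsoTree N d₂)
      (U : Matrix (Fin d₁ × Fin d₂) (Fin d) ℂ) : IsoTree N d

namespace IsoTree

/-- All tensors of the tree are isometries. -/
def IsIsometric {N : ℕ} : {d : ℕ} → IsoTree N d → Prop
  | _, .leaf _ => True
  | _, .node l r U => Uᴴ * U = 1 ∧ l.IsIsometric ∧ r.IsIsometric

/-- The contraction of the tree. -/
noncomputable def contract {N : ℕ} : {d : ℕ} → IsoTree N d → (Fin N → Fin 2) → Fin d → ℂ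
  | _, .leaf q, x, k => if x q = k then 1 else 0
  | _, .node l r U, x, k => ∑ i, ∑ j, U (i, j) k * l.contract x i * r.contract x j

end IsoTree

/-- A layer of the tree-based pass: a chain of tensors connected by horizontal bonds, each with the
subtree that hangs on its vertical leg. -/
inductive TreeChain (N : ℕ) : ℕ → ℕ → Type
  | nil (a : ℕ) : TreeChain N a a
  | cons {a m b d : ℕ} (t : IsoTree N d) (A : Fin d → Matrix (Fin a) (Fin m) ℂ)
      (rest : TreeChain N m b) : TreeChain N a b

/-- Number of tensors in a layer. -/
def TreeChain.length {N : ℕ} : {a b : ℕ} → TreeChain N a b → ℕ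
  | _, _, .nil _ => 0
  | _, _, .cons _ _ rest => rest.length + 1

/-- An MPS as the initial layer, its `i`-th tensor having the physical leg `f i`. -/
def MPS.toChain {N : ℕ} : {n a b : ℕ} → MPS n a b → (Fin n → Fin N) → TreeChain N a b
  | _, _, _, .nil a, _ => .nil a
  | _, _, _, .cons A rest, f => .cons (.leaf (f 0)) A (rest.toChain (Fin.tail f))

/-- One layer of the tree-based pass: neighbouring tensors are merged in pairs and reshaped into a
matrix from their two horizontal legs to their two vertical legs; in its compact SVD
`U diag(s) Vᴴ`, the isometry `U` becomes a node of the tree, and `diag(s) Vᴴ` a tensor of the next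
layer.  An unpaired last tensor is propagated to the next layer. -/
inductive TreeLayer {N : ℕ} : {a b : ℕ} → TreeChain N a b → TreeChain N a b → Prop
  | nil (a : ℕ) : TreeLayer (.nil a) (.nil a)
  | unpaired {a b d : ℕ} (t : IsoTree N d) (A : Fin d → Matrix (Fin a) (Fin b) ℂ) :
      TreeLayer (.cons t A (.nil b)) (.cons t A (.nil b))
  | pair {a m c b d₁ d₂ r : ℕ}
      (t₁ : IsoTree N d₁) (A : Fin d₁ → Matrix (Fin a) (Fin m) ℂ)
      (t₂ : IsoTree N d₂) (B : Fin d₂ → Matrix (Fin m) (Fin c) ℂ)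
      {rest rest' : TreeChain N c b}
      (U : Matrix (Fin d₁ × Fin d₂) (Fin r) ℂ) (s : Fin r → ℝ)
      (V : Matrix (Fin a × Fin c) (Fin r) ℂ)
      (hsvd : IsCompactSVD
        (Matrix.of fun (p : Fin d₁ × Fin d₂) (q : Fin a × Fin c) => (A p.1 * B p.2) q.1 q.2) U s V)
      (hrest : TreeLayer rest rest') :
      TreeLayer (.cons t₁ A (.cons t₂ B rest))
        (.cons (.node t₁ t₂ U) (fun k => Matrix.of fun α γ => (s k : ℂ) * Vᴴ k (α, γ)) rest')

/-- The tree-based pass: layers are processed until two tensors are left.  Their merged tensor, a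
single column, is the top of the tree. -/
inductive TreePass {N : ℕ} : TreeChain N 1 1 → IsoTree N 1 → Prop
  | layer {c c' : TreeChain N 1 1} {t : IsoTree N 1} (hlen : 3 ≤ c.length)
      (hc : TreeLayer c c') (ht : TreePass c' t) : TreePass c t
  | top {m d₁ d₂ : ℕ}
      (t₁ : IsoTree N d₁) (A : Fin d₁ → Matrix (Fin 1) (Fin m) ℂ)
      (t₂ : IsoTree N d₂) (B : Fin d₂ → Matrix (Fin m) (Fin 1) ℂ) :
      TreePass (.cons t₁ A (.cons t₂ B (.nil 1)))
        (.node t₁ t₂ (Matrix.of fun p _ => (A p.1 * B p.2) 0 0))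

/-! ## Isometries to circuits -/

/-- The basis string of `n` qubits that is `α` on the first `m` and `0` on the others. -/
def padZero {m n : ℕ} (α : Fin m → Fin 2) : Fin n → Fin 2 :=
  fun i => if h : i.val < m then α ⟨i.val, h⟩ else 0

/-- A method that compiles each `2^n × 2^m` isometry `V` into a circuit on `n` qubits that maps
`|α⟩|0^(n-m)⟩` to `V|α⟩`, up to a global phase. -/
structure IsometrySynthesis where
  circuit : {m n : ℕ} → m ≤ n → Matrix (Fin n → Fin 2) (Fin m → Fin 2) ℂ → Circuit n
  correct : ∀ {m n : ℕ} (h : m ≤ n) (V : Matrix (Fin n → Fin 2) (Fin m → Fin 2) ℂ),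
    Vᴴ * V = 1 → ∃ z : ℂ, ‖z‖ = 1 ∧
      ∀ α x, (circuit h V).run (basisState (padZero α)) x = z * V x α

/-- The basis states of a leg of dimension `d`, written in binary on `⌈log₂ d⌉` qubits. -/
def enc {d : ℕ} (k : Fin d) : Fin (Nat.clog 2 d) → Fin 2 :=
  finFunctionFinEquiv.symm (Fin.castLE (Nat.le_pow_clog one_lt_two d) k)

/-- `V` is an isometry that pads the tensor `U` to dimensions that are powers of `2`.
(The entries of the columns `enc k` that are not prescribed vanish if `U` is an isometry.) -/
structure IsPadding {d₁ d₂ d : ℕ} (U : Matrix (Fin d₁ × Fin d₂) (Fin d) ℂ)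
    (V : Matrix (Fin (Nat.clog 2 d₁ + Nat.clog 2 d₂) → Fin 2) (Fin (Nat.clog 2 d) → Fin 2) ℂ) :
    Prop where
  isometry : Vᴴ * V = 1
  extends_tensor : ∀ i j k, V (Fin.append (enc i) (enc j)) (enc k) = U (i, j) k

/-- `TreeCircuit σ t e c`: the circuit `c` is compiled from the tree `t`, whose lower leg is carried
by the qubits `e`.  A node acts on the qubits of its two upper legs; its lower leg is carried by the
first of these qubits, the others being in the state `0` before. The circuit of a node comes before
those of its two subtrees. -/
inductive TreeCircuit {N : ℕ} (σ : IsometrySynthesis) :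
    {d : ℕ} → IsoTree N d → (Fin (Nat.clog 2 d) ↪ Fin N) → Circuit N → Prop
  | leaf (q : Fin N) (e : Fin (Nat.clog 2 2) ↪ Fin N) (he : ∀ i, e i = q) :
      TreeCircuit σ (.leaf q) e []
  | node {d₁ d₂ d : ℕ} {l : IsoTree N d₁} {r : IsoTree N d₂}
      {el : Fin (Nat.clog 2 d₁) ↪ Fin N} {er : Fin (Nat.clog 2 d₂) ↪ Fin N} {cl cr : Circuit N}
      (U : Matrix (Fin d₁ × Fin d₂) (Fin d) ℂ)
      (V : Matrix (Fin (Nat.clog 2 d₁ + Nat.clog 2 d₂) → Fin 2) (Fin (Nat.clog 2 d) → Fin 2) ℂ)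
      (hV : IsPadding U V)
      (hd : Nat.clog 2 d ≤ Nat.clog 2 d₁ + Nat.clog 2 d₂)
      (e : Fin (Nat.clog 2 d₁ + Nat.clog 2 d₂) ↪ Fin N)
      (hel : ∀ i, e (Fin.castAdd _ i) = el i) (her : ∀ i, e (Fin.natAdd _ i) = er i)
      (hl : TreeCircuit σ l el cl) (hr : TreeCircuit σ r er cr) :
      TreeCircuit σ (.node l r U) ((Fin.castLEEmb hd).trans e)
        ((σ.circuit hd V).map (Gate.map e) ++ (cl ++ cr))

/-! ## The pipeline -/

/-- `Pipeline σ ρ L N t c`: a run of the tree-based pipeline for the target language `L` on `N`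
qubits, through the automaton representation `ρ`, produces the tree tensor network `t` and the
circuit `c`. -/
def Pipeline (σ : IsometrySynthesis) (ρ : Route) (L : Language (Fin 2)) (N : ℕ)
    (t : IsoTree N 1) (c : Circuit N) : Prop :=
  ∃ (M M' : MPS N 1 1) (e : Fin (Nat.clog 2 1) ↪ Fin N),
    FrontEnd L N ρ M ∧ SeqSVD M M' ∧ TreePass (M'.toChain id) t ∧ TreeCircuit σ t e c

end TreeRLSP

/-!
The circuit of a run is correct because each step of the pipeline leaves the represented state
unchanged, and it is small because each leg of the tree has dimension at most a constant times the
square of the maximal Schmidt rank `χ` of `|L_N⟩`.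

*Synthesis.* A rotation of one qubit about the `z`-axis by an angle that depends on `k` control
qubits costs `O(2^k)` gates, since one more control doubles the circuit up to two CNOT gates
(`exists_multiplexedRz`).  Hence so do arbitrary diagonal unitaries up to a global phase
(`exists_diagonal`), multiplexed real rotations (`exists_multiplexedRy`), and the preparation of
arbitrary states (`exists_prepares`).  A complex Householder reflection is a diagonal unitary
conjugated by a state preparation (`exists_reflection`), and one such reflection per column turns
the basis states into the columns of an isometry (`exists_circuit_columns`).  An isometry from `m`
to `n` qubits therefore costs `2^m · O(2^n)` gates (`exists_isometrySynthesis`).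

*Canonical form.* The automata represent the indicator function of the language (`FrontEnd.eval`)
and the double sweep normalizes it (`SeqSVD.eval`).  After the right sweep all tensors are right
isometries, and the left sweep collects left isometries, so that across each cut the state factors
as `P diag(s) Vᴴ Q` with a left isometry `P` and a right isometry `Q`.  The bond dimension is thus
at most the Schmidt rank (`LeftSweep.bondsLE`).  A language and its complement have indicator
matrices that differ, up to sign, by a matrix of rank one, so passing to the complement at most
doubles `χ` (`rank_cut_le_two_mul`).

*Tree.* A layer of the tree-based pass preserves the contraction (`TreeLayer.contract_eq`), the
order of the leaves and the norm (`TreeLayer.gram_eq`); the last one makes the top of the tree an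
isometry (`TreePass.isIsometric`).  A new vertical leg has at most the dimension of the two
horizontal legs of its tensor, at most `(2χ)²` (`TreeLayer.allTrees_legsLE`).  Each layer halves
the number of tensors, so the height is at most `⌈log₂ N⌉` (`TreePass.height_le`).

*Circuit.* By induction on the tree, the circuit of a subtree maps the encoded value `k` of its
lower leg, with its other qubits in `|0⟩`, to its contraction (`TreeCircuit.run_basisState`);
subtrees own disjoint sets of qubits.  A node has three legs of dimension `O(χ²)` and costs
`O(χ⁶)` gates.  There are `N - 1` nodes, which bounds the gate count (`TreeCircuit.length_le`), and
siblings act in parallel, which bounds the depth by the height (`TreeCircuit.foldl_tick_le`).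
-/

namespace TreeRLSP

/-! ### Circuits as linear maps -/

theorem Gate.apply_add {N : ℕ} (g : Gate N) (ψ φ : State N) :
    g.apply (ψ + φ) = g.apply ψ + g.apply φ := by
  cases g with
  | one q u => funext x; simp [Gate.apply, mul_add, Finset.sum_add_distrib]
  | cnot c t h => funext x; simp [Gate.apply]

theorem Gate.apply_smul {N : ℕ} (g : Gate N) (z : ℂ) (ψ : State N) :
    g.apply (z • ψ) = z • g.apply ψ := by
  cases g with
  | one q u => funext x; simp [Gate.apply, mul_left_comm, mul_add]
  | cnot c t h => funext x; simp [Gate.apply]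

namespace Circuit

@[simp] theorem run_nil {N : ℕ} (ψ : State N) : run [] ψ = ψ := rfl

@[simp] theorem run_cons {N : ℕ} (g : Gate N) (c : Circuit N) (ψ : State N) :
    run (g :: c) ψ = run c (g.apply ψ) := rfl

@[simp] theorem run_append {N : ℕ} (c d : Circuit N) (ψ : State N) :
    run (c ++ d) ψ = run d (run c ψ) := by
  simp [run]

theorem run_add {N : ℕ} (c : Circuit N) (ψ φ : State N) :
    c.run (ψ + φ) = c.run ψ + c.run φ := by
  induction c generalizing ψ φ with
  | nil => rfl
  | cons g c ih => simp [Gate.apply_add, ih]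

theorem run_smul {N : ℕ} (c : Circuit N) (z : ℂ) (ψ : State N) :
    c.run (z • ψ) = z • c.run ψ := by
  induction c generalizing ψ with
  | nil => rfl
  | cons g c ih => simp [Gate.apply_smul, ih]

/-- The action of a circuit as a linear map. -/
def runLinear {N : ℕ} (c : Circuit N) : State N →ₗ[ℂ] State N where
  toFun := c.run
  map_add' := c.run_add
  map_smul' := c.run_smul

theorem run_zero {N : ℕ} (c : Circuit N) : c.run 0 = 0 := c.runLinear.map_zero

theorem run_sum {N : ℕ} {ι : Type*} (c : Circuit N) (s : Finset ι) (f : ι → State N) :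
    c.run (∑ i ∈ s, f i) = ∑ i ∈ s, c.run (f i) := map_sum c.runLinear f s

end Circuit

/-! ### Inverse circuits and unitarity -/

/-- The inverse gate. -/
def Gate.inv {N : ℕ} : Gate N → Gate N
  | .one q u => .one q u⁻¹
  | .cnot c t h => .cnot c t h

theorem fin_two_add_add (a b : Fin 2) : a + b + b = a := by
  revert a b; decide

theorem Gate.apply_one_one {N : ℕ} (q : Fin N) (u v : Matrix.unitaryGroup (Fin 2) ℂ)
    (h : u * v = 1) (ψ : State N) : (Gate.one q u).apply ((Gate.one q v).apply ψ) = ψ := by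
  funext x
  have hM : (u : Matrix (Fin 2) (Fin 2) ℂ) * (v : Matrix (Fin 2) (Fin 2) ℂ) = 1 := by
    rw [← Matrix.UnitaryGroup.mul_val, h]; rfl
  simp only [Gate.apply, Function.update_self, Function.update_idem, Finset.mul_sum]
  rw [Finset.sum_comm]
  have : ∀ b, ∑ i, (u : Matrix (Fin 2) (Fin 2) ℂ) (x q) i *
      ((v : Matrix (Fin 2) (Fin 2) ℂ) i b * ψ (Function.update x q b)) =
      (if x q = b then 1 else 0) * ψ (Function.update x q b) := by
    intro b
    have hb := congrFun (congrFun hM (x q)) b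
    rw [Matrix.mul_apply, Matrix.one_apply] at hb
    rw [← hb, Finset.sum_mul]
    exact Finset.sum_congr rfl fun i _ => by ring
  simp [this]

theorem Gate.cnot_cnot {N : ℕ} (a t : Fin N) (h : a ≠ t) (ψ : State N) :
    (Gate.cnot a t h).apply ((Gate.cnot a t h).apply ψ) = ψ := by
  funext x
  simp [Gate.apply, h, fin_two_add_add]

theorem Gate.inv_apply_apply {N : ℕ} (g : Gate N) (ψ : State N) :
    g.inv.apply (g.apply ψ) = ψ := by
  cases g with
  | one q u => exact Gate.apply_one_one q _ _ (inv_mul_cancel u) ψ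
  | cnot c t h => exact Gate.cnot_cnot c t h ψ

theorem Gate.apply_inv_apply {N : ℕ} (g : Gate N) (ψ : State N) :
    g.apply (g.inv.apply ψ) = ψ := by
  cases g with
  | one q u => exact Gate.apply_one_one q _ _ (mul_inv_cancel u) ψ
  | cnot c t h => exact Gate.cnot_cnot c t h ψ

/-- The inverse gate is the adjoint gate. -/
theorem Gate.star_dotProduct_apply {N : ℕ} (g : Gate N) (ψ φ : State N) :
    star ψ ⬝ᵥ g.apply φ = star (g.inv.apply ψ) ⬝ᵥ φ := by
  cases g with
  | one q u =>
    simp only [dotProduct, Gate.apply, Gate.inv, Pi.star_apply, Finset.mul_sum, star_sum,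
      Finset.sum_mul, star_mul']
    rw [← Fintype.sum_prod_type', ← Fintype.sum_prod_type']
    -- exchange the value of the qubit `q` with the summation index
    refine Fintype.sum_equiv
      ⟨fun p => (Function.update p.1 q p.2, p.1 q), fun p => (Function.update p.1 q p.2, p.1 q),
        fun p => by simp, fun p => by simp⟩ _ _ fun p => ?_
    simp only [Equiv.coe_fn_mk, Function.update_self, Function.update_idem,
      Function.update_eq_self]
    have : ((u⁻¹ : Matrix.unitaryGroup (Fin 2) ℂ) : Matrix (Fin 2) (Fin 2) ℂ) p.2 (p.1 q)
        = star ((u : Matrix (Fin 2) (Fin 2) ℂ) (p.1 q) p.2) := by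
      rw [Matrix.UnitaryGroup.inv_val]; rfl
    rw [this, star_star]
    ring
  | cnot c t h =>
    simp only [dotProduct, Gate.apply, Gate.inv, Pi.star_apply]
    refine Fintype.sum_equiv
      ⟨fun x => Function.update x t (x t + x c), fun x => Function.update x t (x t + x c),
        fun x => by simp [h, fin_two_add_add], fun x => by simp [h, fin_two_add_add]⟩
      _ _ fun x => ?_
    simp [h, fin_two_add_add]

namespace Circuit

/-- The inverse circuit. -/
def inv {N : ℕ} (c : Circuit N) : Circuit N := (List.map Gate.inv c).reverse

theorem length_inv {N : ℕ} (c : Circuit N) : c.inv.length = c.length := by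
  simp [inv]

theorem run_inv_run {N : ℕ} (c : Circuit N) (ψ : State N) : c.inv.run (c.run ψ) = ψ := by
  induction c generalizing ψ with
  | nil => rfl
  | cons g c ih =>
    have : inv (g :: c) = inv c ++ [g.inv] := by simp [inv]
    rw [this, run_append]
    change g.inv.apply (run (inv c) (run c (g.apply ψ))) = ψ
    rw [ih, g.inv_apply_apply]

theorem run_run_inv {N : ℕ} (c : Circuit N) (ψ : State N) : c.run (c.inv.run ψ) = ψ := by
  induction c generalizing ψ with
  | nil => rfl
  | cons g c ih =>
    have : inv (g :: c) = inv c ++ [g.inv] := by simp [inv]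
    rw [this, run_append, run_cons]
    change run c (g.apply (g.inv.apply _)) = ψ
    rw [g.apply_inv_apply, ih]

theorem star_dotProduct_run {N : ℕ} (c : Circuit N) (ψ φ : State N) :
    star ψ ⬝ᵥ c.run φ = star (c.inv.run ψ) ⬝ᵥ φ := by
  induction c generalizing ψ φ with
  | nil => rfl
  | cons g c ih =>
    have : inv (g :: c) = inv c ++ [g.inv] := by simp [inv]
    rw [this, run_append, run_cons, ih, Gate.star_dotProduct_apply]
    rfl

theorem star_run_dotProduct_run {N : ℕ} (c : Circuit N) (ψ φ : State N) :
    star (c.run ψ) ⬝ᵥ c.run φ = star ψ ⬝ᵥ φ := by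
  rw [star_dotProduct_run, run_inv_run]

end Circuit

/-! ### Circuits placed on a subset of the qubits -/

theorem extend_extend {n N : ℕ} (e : Fin n ↪ Fin N) (w w' : Fin n → Fin 2) (x : Fin N → Fin 2) :
    Function.extend e w' (Function.extend e w x) = Function.extend e w' x := by
  funext i
  by_cases h : ∃ j, e j = i
  · obtain ⟨j, rfl⟩ := h
    simp [e.injective.extend_apply]
  · simp [Function.extend_apply' _ _ _ h]

theorem extend_comp_self {n N : ℕ} (e : Fin n ↪ Fin N) (x : Fin N → Fin 2) :
    Function.extend e (x ∘ e) x = x := by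
  funext i
  by_cases h : ∃ j, e j = i
  · obtain ⟨j, rfl⟩ := h
    simp [e.injective.extend_apply]
  · simp [Function.extend_apply' _ _ _ h]

theorem extend_comp {n N : ℕ} (e : Fin n ↪ Fin N) (w : Fin n → Fin 2) (x : Fin N → Fin 2) :
    Function.extend e w x ∘ e = w :=
  Function.extend_comp e.injective w x

theorem extend_update {n N : ℕ} (e : Fin n ↪ Fin N) (w : Fin n → Fin 2) (x : Fin N → Fin 2)
    (q : Fin n) (b : Fin 2) :
    Function.extend e (Function.update w q b) x =
      Function.update (Function.extend e w x) (e q) b := by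
  funext i
  by_cases h : ∃ j, e j = i
  · obtain ⟨j, rfl⟩ := h
    by_cases hj : j = q
    · subst hj; simp [e.injective.extend_apply]
    · simp [e.injective.extend_apply, hj]
  · have : i ≠ e q := fun h' => h ⟨q, h'.symm⟩
    simp [Function.extend_apply' _ _ _ h, this]

theorem Gate.map_apply {n N : ℕ} (e : Fin n ↪ Fin N) (g : Gate n) (ψ : State N)
    (x : Fin N → Fin 2) :
    (Gate.map e g).apply ψ x = g.apply (fun w => ψ (Function.extend e w x)) (x ∘ e) := by
  cases g with
  | one q u => simp [Gate.map, Gate.apply, extend_update, extend_comp_self]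
  | cnot c t h => simp [Gate.map, Gate.apply, extend_update, extend_comp_self]

/-- A circuit placed on other wires acts on each slice in which the remaining qubits are fixed. -/
theorem Circuit.run_map {n N : ℕ} (e : Fin n ↪ Fin N) (c : Circuit n) (ψ : State N)
    (x : Fin N → Fin 2) :
    Circuit.run (List.map (Gate.map e) c) ψ x =
      c.run (fun w => ψ (Function.extend e w x)) (x ∘ e) := by
  induction c generalizing ψ with
  | nil => simp [extend_comp_self]
  | cons g c ih =>
    rw [List.map_cons, Circuit.run_cons, Circuit.run_cons, ih]
    congr 1
    funext w
    rw [Gate.map_apply, extend_comp]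
    simp only [extend_extend]

/-! ### Multiplexed rotations and diagonal unitaries -/

/-- The sign `(-1)^b`. -/
def sgn (b : Fin 2) : ℝ := if b = 0 then 1 else -1

theorem sgn_add (a b : Fin 2) : sgn (a + b) = sgn a * sgn b := by
  fin_cases a <;> fin_cases b <;> simp [sgn]

/-- A phase function on bit strings that reads only the qubits in `ws`. -/
def ReadsOnly {n : ℕ} (ws : List (Fin n)) (φ : (Fin n → Fin 2) → ℝ) : Prop :=
  ∀ x y, (∀ i ∈ ws, x i = y i) → φ x = φ y

/-- A function that reads `a :: ws` splits as `φ₊ + (-1)^{x_a} φ₋`, where `φ₊` and `φ₋` read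
only `ws`. -/
theorem ReadsOnly.split {n : ℕ} {a : Fin n} {ws : List (Fin n)} {φ : (Fin n → Fin 2) → ℝ}
    (h : ReadsOnly (a :: ws) φ) : ∃ p m : (Fin n → Fin 2) → ℝ,
      ReadsOnly ws p ∧ ReadsOnly ws m ∧ ∀ x, φ x = p x + sgn (x a) * m x := by
  have key : ∀ b x y, (∀ i ∈ ws, x i = y i) →
      φ (Function.update x a b) = φ (Function.update y a b) := by
    intro b x y hxy
    refine h _ _ fun i hi => ?_
    by_cases hia : i = a
    · subst hia; simp
    · rcases List.mem_cons.1 hi with rfl | hi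
      · exact absurd rfl hia
      · simp [hia, hxy i hi]
  refine ⟨fun x => (φ (Function.update x a 0) + φ (Function.update x a 1)) / 2,
    fun x => (φ (Function.update x a 0) - φ (Function.update x a 1)) / 2, ?_, ?_, ?_⟩
  · intro x y hxy
    simp only [key _ x y hxy]
  · intro x y hxy
    simp only [key _ x y hxy]
  · intro x
    rcases (by omega : x a = 0 ∨ x a = 1) with h0 | h0
    · have : Function.update x a 0 = x := by rw [← h0, Function.update_eq_self]
      simp only [this, h0, sgn]; simp; ring
    · have : Function.update x a 1 = x := by rw [← h0, Function.update_eq_self]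
      simp only [this, h0, sgn]; simp; ring

/-- The one-qubit unitary `diag(e^{iβ}, e^{-iβ})`. -/
noncomputable def rz (β : ℝ) : Matrix.unitaryGroup (Fin 2) ℂ :=
  ⟨Matrix.diagonal fun b => Complex.exp ((sgn b * β : ℝ) * Complex.I), by
    rw [Matrix.mem_unitaryGroup_iff, Matrix.star_eq_conjTranspose, Matrix.diagonal_conjTranspose,
      Matrix.diagonal_mul_diagonal, ← Matrix.diagonal_one]
    congr 1
    funext b
    have := Complex.mul_conj (Complex.exp ((sgn b * β : ℝ) * Complex.I))
    rw [Complex.normSq_eq_norm_sq, Complex.norm_exp_ofReal_mul_I] at this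
    simpa using this⟩

/-- A `z`-rotation of the qubit `t` by an angle that depends on the control qubits `cs`.  One more
control doubles the circuit, up to two CNOT gates: conjugation by a CNOT flips the sign of the
angle. -/
theorem exists_multiplexedRz {n : ℕ} (t : Fin n) (cs : List (Fin n)) (ht : t ∉ cs)
    (β : (Fin n → Fin 2) → ℝ) (hβ : ReadsOnly cs β) :
    ∃ c : Circuit n, c.length + 2 ≤ 3 * 2 ^ cs.length ∧
      ∀ ψ x, c.run ψ x = Complex.exp ((sgn (x t) * β x : ℝ) * Complex.I) * ψ x := by
  induction cs generalizing β with
  | nil =>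
    refine ⟨[Gate.one t (rz (β 0))], by simp, fun ψ x => ?_⟩
    have : β x = β 0 := hβ _ _ (by simp)
    rw [this]
    simp only [Circuit.run_cons, Circuit.run_nil, Gate.apply, rz]
    rw [Finset.sum_eq_single (x t)]
    · simp
    · intro b _ hb; simp [hb.symm]
    · simp
  | cons a cs ih =>
    obtain ⟨p, m, hp, hm, h⟩ := hβ.split
    have hta : a ≠ t := fun h => ht (by simp [h])
    have htc : t ∉ cs := fun h => ht (by simp [h])
    obtain ⟨c₁, hc₁, h₁⟩ := ih htc p hp
    obtain ⟨c₂, hc₂, h₂⟩ := ih htc m hm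
    refine ⟨c₁ ++ ([Gate.cnot a t hta] ++ (c₂ ++ [Gate.cnot a t hta])), ?_, fun ψ x => ?_⟩
    · simp only [List.length_append, List.length_cons, List.length_nil, pow_succ]; omega
    · simp only [Circuit.run_append, Circuit.run_cons, Circuit.run_nil]
      have hmx : m (Function.update x t (x t + x a)) = m x := by
        refine hm _ _ fun i hi => ?_
        rw [Function.update_of_ne]
        rintro rfl; exact htc hi
      have e1 : (Gate.cnot a t hta).apply (c₂.run ((Gate.cnot a t hta).apply (c₁.run ψ))) x
          = c₂.run ((Gate.cnot a t hta).apply (c₁.run ψ)) (Function.update x t (x t + x a)) := rfl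
      rw [e1, h₂, hmx]
      have e2 : (Gate.cnot a t hta).apply (c₁.run ψ) (Function.update x t (x t + x a))
          = c₁.run ψ x := by
        simp [Gate.apply, hta, fin_two_add_add]
      rw [e2, h₁, ← mul_assoc, ← Complex.exp_add, h x, Function.update_self, sgn_add]
      congr 2
      push_cast
      ring

/-- Diagonal unitaries on the qubits `ws` cost `O(2^|ws|)` gates, up to a global phase. -/
theorem exists_diagonal_on {n : ℕ} (ws : List (Fin n)) (hws : ws.Nodup)
    (φ : (Fin n → Fin 2) → ℝ) (hφ : ReadsOnly ws φ) :
    ∃ c : Circuit n, c.length ≤ 3 * 2 ^ ws.length ∧ ∃ z : ℂ, ‖z‖ = 1 ∧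
      ∀ ψ x, c.run ψ x = z * (Complex.exp ((φ x : ℝ) * Complex.I) * ψ x) := by
  induction ws generalizing φ with
  | nil =>
    refine ⟨[], by simp, Complex.exp ((-φ 0 : ℝ) * Complex.I),
      Complex.norm_exp_ofReal_mul_I _, fun ψ x => ?_⟩
    rw [hφ x 0 (by simp), ← mul_assoc, ← Complex.exp_add]
    simp
  | cons a ws ih =>
    obtain ⟨p, m, hp, hm, h⟩ := hφ.split
    obtain ⟨c₁, hc₁, z, hz, h₁⟩ := ih (List.nodup_cons.1 hws).2 p hp
    obtain ⟨c₂, hc₂, h₂⟩ := exists_multiplexedRz a ws (List.nodup_cons.1 hws).1 m hm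
    refine ⟨c₁ ++ c₂, ?_, z, hz, fun ψ x => ?_⟩
    · simp only [List.length_append, List.length_cons, pow_succ]; omega
    · rw [Circuit.run_append, h₂, h₁, h x]
      push_cast
      rw [add_mul, Complex.exp_add]
      ring

theorem exists_diagonal {n : ℕ} (φ : (Fin n → Fin 2) → ℝ) :
    ∃ c : Circuit n, c.length ≤ 3 * 2 ^ n ∧ ∃ z : ℂ, ‖z‖ = 1 ∧
      ∀ ψ x, c.run ψ x = z * (Complex.exp ((φ x : ℝ) * Complex.I) * ψ x) := by
  have := exists_diagonal_on (List.finRange n) (List.nodup_finRange n) φ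
    (fun x y h => by rw [funext fun i => h i (List.mem_finRange i)])
  simpa using this

/-- The change of basis that diagonalizes the real plane rotations. -/
noncomputable def rotBasis : Matrix.unitaryGroup (Fin 2) ℂ :=
  ⟨!![(((Real.sqrt 2)⁻¹ : ℝ) : ℂ), (((Real.sqrt 2)⁻¹ : ℝ) : ℂ);
      -(((Real.sqrt 2)⁻¹ : ℝ) : ℂ) * Complex.I, (((Real.sqrt 2)⁻¹ : ℝ) : ℂ) * Complex.I], by
    have h : (((Real.sqrt 2)⁻¹ : ℝ) : ℂ) * (((Real.sqrt 2)⁻¹ : ℝ) : ℂ) = 1 / 2 := by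
      rw [← Complex.ofReal_mul, ← mul_inv, Real.mul_self_sqrt (by norm_num)]; norm_num
    have hc := Complex.conj_ofReal (Real.sqrt 2)⁻¹
    rw [Matrix.mem_unitaryGroup_iff, Matrix.star_eq_conjTranspose]
    generalize Complex.ofReal (Real.sqrt 2)⁻¹ = s at *
    ext i j
    fin_cases i <;> fin_cases j <;>
      simp [Matrix.mul_apply, Fin.sum_univ_two, hc] <;> ring_nf <;>
      simp [pow_two, h]⟩

/-- A real rotation of the qubit `t` by an angle that depends on the control qubits `cs`. -/
theorem exists_multiplexedRy {n : ℕ} (t : Fin n) (cs : List (Fin n)) (ht : t ∉ cs)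
    (θ : (Fin n → Fin 2) → ℝ) (hθ : ReadsOnly cs θ) :
    ∃ c : Circuit n, c.length ≤ 3 * 2 ^ cs.length ∧ ∀ ψ x, c.run ψ x =
      if x t = 0 then
        Real.cos (θ x) * ψ (Function.update x t 0) - Real.sin (θ x) * ψ (Function.update x t 1)
      else
        Real.sin (θ x) * ψ (Function.update x t 0) +
          Real.cos (θ x) * ψ (Function.update x t 1) := by
  obtain ⟨c, hc, h⟩ := exists_multiplexedRz t cs ht θ hθ
  refine ⟨[Gate.one t rotBasis⁻¹] ++ (c ++ [Gate.one t rotBasis]), ?_, fun ψ x => ?_⟩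
  · simp only [List.length_append, List.length_cons, List.length_nil]; omega
  · have hx : ∀ b, θ (Function.update x t b) = θ x := fun b => hθ _ _ fun i hi => by
      rw [Function.update_of_ne]
      rintro rfl; exact ht hi
    have hs : (((Real.sqrt 2)⁻¹ : ℝ) : ℂ) * (((Real.sqrt 2)⁻¹ : ℝ) : ℂ) = 1 / 2 := by
      rw [← Complex.ofReal_mul, ← mul_inv, Real.mul_self_sqrt (by norm_num)]; norm_num
    have hc := Complex.conj_ofReal (Real.sqrt 2)⁻¹
    have e1 : Complex.exp (((θ x : ℝ) : ℂ) * Complex.I) =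
        Real.cos (θ x) + Real.sin (θ x) * Complex.I := by
      rw [Complex.exp_mul_I]; push_cast; rfl
    have e2 : Complex.exp (-((θ x : ℝ) : ℂ) * Complex.I) =
        Real.cos (θ x) - Real.sin (θ x) * Complex.I := by
      rw [Complex.exp_mul_I, Complex.cos_neg, Complex.sin_neg]; push_cast; ring
    simp only [Circuit.run_append, Circuit.run_cons, Circuit.run_nil]
    simp only [Gate.apply, h, hx, Function.update_self, Function.update_idem,
      Matrix.UnitaryGroup.inv_val, Matrix.star_eq_conjTranspose, rotBasis, Fin.sum_univ_two,
      Matrix.conjTranspose_apply, sgn]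
    generalize Complex.ofReal (Real.sqrt 2)⁻¹ = s at *
    generalize ψ (Function.update x t 0) = a
    generalize ψ (Function.update x t 1) = b
    simp only [if_true, one_mul, one_ne_zero, if_false, neg_mul, Complex.ofReal_neg, e1] at e2 ⊢
    simp only [e2]
    generalize (Real.cos (θ x) : ℂ) = C
    generalize (Real.sin (θ x) : ℂ) = S
    have hI := Complex.I_mul_I
    rcases (by omega : x t = 0 ∨ x t = 1) with h0 | h0 <;> simp [h0, hc]
    · linear_combination (2 * (C * a - S * b)) * hs + s * s * S * b * 2 * hI
    · linear_combination (2 * (S * a + C * b)) * hs - s * s * S * a * 2 * hI -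
        s * s * C * b * 2 * hI

/-! ### State preparation -/

theorem sum_cons {n : ℕ} {M : Type*} [AddCommMonoid M] (f : (Fin (n + 1) → Fin 2) → M) :
    ∑ x, f x = ∑ b, ∑ x, f (Fin.cons b x) := by
  rw [← Fintype.sum_prod_type']
  exact (Fintype.sum_equiv (Fin.consEquiv fun _ => Fin 2) _ _ fun p => rfl).symm

theorem exists_polar (a b : ℝ) :
    ∃ θ : ℝ, a = Real.sqrt (a ^ 2 + b ^ 2) * Real.cos θ ∧
      b = Real.sqrt (a ^ 2 + b ^ 2) * Real.sin θ := by
  have h : ‖(⟨a, b⟩ : ℂ)‖ = Real.sqrt (a ^ 2 + b ^ 2) := by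
    rw [Complex.norm_def, Complex.normSq_mk]; ring_nf
  refine ⟨Complex.arg ⟨a, b⟩, ?_, ?_⟩
  · rw [← h, Complex.norm_mul_cos_arg]
  · rw [← h, Complex.norm_mul_sin_arg]

/-- Real nonnegative states are prepared qubit by qubit: the marginal amplitudes on the last `n`
qubits first, then the first qubit by a multiplexed rotation. -/
theorem exists_prepares_nonneg {n : ℕ} (r : (Fin n → Fin 2) → ℝ) (h0 : ∀ x, 0 ≤ r x)
    (h1 : ∑ x, r x ^ 2 = 1) :
    ∃ c : Circuit n, c.length ≤ 3 * 2 ^ n ∧ ∃ z : ℂ, ‖z‖ = 1 ∧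
      ∀ x, c.run (basisState fun _ => 0) x = z * r x := by
  induction n with
  | zero =>
    refine ⟨[], by simp, 1, by simp, fun x => ?_⟩
    have hx : x = fun _ => 0 := Subsingleton.elim _ _
    rw [Fintype.sum_subsingleton _ x] at h1
    have : r x = 1 := by nlinarith [h0 x]
    rw [this, hx]
    simp [basisState]
  | succ n ih =>
    let r' : (Fin n → Fin 2) → ℝ := fun x => Real.sqrt (r (Fin.cons 0 x) ^ 2 + r (Fin.cons 1 x) ^ 2)
    obtain ⟨c, hc, z, hz, h⟩ := ih r' (fun x => Real.sqrt_nonneg _) (by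
      rw [sum_cons, Fin.sum_univ_two, ← Finset.sum_add_distrib] at h1
      rw [← h1]
      exact Finset.sum_congr rfl fun x _ => Real.sq_sqrt (by positivity))
    choose θ hθ0 hθ1 using fun x : Fin n → Fin 2 =>
      exists_polar (r (Fin.cons 0 x)) (r (Fin.cons 1 x))
    obtain ⟨d, hd, h'⟩ := exists_multiplexedRy (0 : Fin (n + 1)) ((List.finRange n).map Fin.succ)
      (by simp [Fin.succ_ne_zero]) (fun x => θ (Fin.tail x)) (fun x y hxy => by
        have : Fin.tail x = Fin.tail y := funext fun i => hxy _ (by simp)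
        simp only [this])
    refine ⟨List.map (Gate.map (Fin.succEmb n)) c ++ d, ?_, z, hz, fun x => ?_⟩
    · simp only [List.length_append, List.length_map, List.length_finRange, pow_succ] at hd ⊢
      omega
    · have key : ∀ b x, Circuit.run (List.map (Gate.map (Fin.succEmb n)) c)
          (basisState fun _ => 0) (Fin.cons b x) = if b = 0 then z * r' x else 0 := by
        intro b x
        rw [Circuit.run_map]
        have e1 : (Fin.cons b x : Fin (n + 1) → Fin 2) ∘ (Fin.succEmb n) = x := by
          funext i; simp
        have e2 : ∀ w : Fin n → Fin 2,
            Function.extend (Fin.succEmb n) w (Fin.cons b x : Fin (n + 1) → Fin 2) =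
              Fin.cons b w := by
          intro w
          funext i
          refine Fin.cases ?_ (fun j => ?_) i
          · rw [Function.extend_apply' _ _ _ (by rintro ⟨j, hj⟩; exact Fin.succ_ne_zero j hj)]
            simp
          · exact ((Fin.succEmb n).injective.extend_apply _ _ _).trans (by simp)
        rw [e1]
        simp only [e2]
        by_cases hb : b = 0
        · subst hb
          rw [if_pos rfl, ← h]
          congr 1
          funext w
          have : (Fin.cons 0 w : Fin (n + 1) → Fin 2) = (fun _ => 0) ↔ w = fun _ => 0 := by
            constructor
            · intro hw; funext i; simpa using congrFun hw i.succ
            · rintro rfl; funext i; refine Fin.cases ?_ (fun j => ?_) i <;> simp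
          simp [basisState, this]
        · rw [if_neg hb]
          have : (fun w => basisState (fun _ => (0 : Fin 2)) (Fin.cons b w : Fin (n + 1) → Fin 2))
              = (0 : State n) := by
            funext w
            refine if_neg fun hw => hb ?_
            simpa using congrFun hw 0
          rw [this, Circuit.run_zero]; rfl
      rw [Circuit.run_append, h']
      obtain ⟨b, w, rfl⟩ : ∃ b w, x = (Fin.cons b w : Fin (n + 1) → Fin 2) :=
        ⟨x 0, Fin.tail x, (Fin.cons_self_tail x).symm⟩
      simp only [Fin.cons_zero, Fin.update_cons_zero, key, Fin.tail_cons]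
      rcases (by omega : b = 0 ∨ b = 1) with rfl | rfl
      · have := congrArg Complex.ofReal (hθ0 w)
        simp only [if_true, one_ne_zero, if_false, mul_zero, sub_zero]
        rw [this]; push_cast; ring
      · have := congrArg Complex.ofReal (hθ1 w)
        simp only [if_true, one_ne_zero, if_false, mul_zero, add_zero]
        rw [this]; push_cast; ring

theorem star_dotProduct_self {ι : Type*} [Fintype ι] (w : ι → ℂ) :
    star w ⬝ᵥ w = ((∑ x, ‖w x‖ ^ 2 : ℝ) : ℂ) := by
  simp only [dotProduct, Pi.star_apply]
  push_cast
  exact Finset.sum_congr rfl fun x _ => Complex.conj_mul' (w x)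

/-- Every state of `n` qubits is prepared by `O(2^n)` gates. -/
theorem exists_prepares {n : ℕ} (w : State n) (hw : star w ⬝ᵥ w = 1) :
    ∃ c : Circuit n, c.length ≤ 6 * 2 ^ n ∧ ∃ z : ℂ, ‖z‖ = 1 ∧
      c.run (basisState fun _ => 0) = z • w := by
  obtain ⟨c, hc, z, hz, h⟩ := exists_prepares_nonneg (fun x => ‖w x‖) (fun x => norm_nonneg _) (by
    rw [star_dotProduct_self] at hw
    exact_mod_cast hw)
  obtain ⟨d, hd, z', hz', h'⟩ := exists_diagonal (fun x => Complex.arg (w x))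
  refine ⟨c ++ d, by simp only [List.length_append]; omega, z * z', by simp [hz, hz'], ?_⟩
  funext x
  rw [Circuit.run_append, h', h]
  have := Complex.norm_mul_exp_arg_mul_I (w x)
  simp only [Pi.smul_apply, smul_eq_mul]
  linear_combination z * z' * this

/-! ### Isometry synthesis by Householder reflections -/

/-- The unitary `1 + (ω - 1) |w⟩⟨w|` is a diagonal unitary conjugated by a state preparation. -/
theorem exists_reflection {n : ℕ} (w : State n) (hw : star w ⬝ᵥ w = 1) (ω : ℂ) (hω : ‖ω‖ = 1) :
    ∃ c : Circuit n, c.length ≤ 15 * 2 ^ n ∧ ∃ z : ℂ, ‖z‖ = 1 ∧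
      ∀ ψ, c.run ψ = z • (ψ + ((ω - 1) * (star w ⬝ᵥ ψ)) • w) := by
  obtain ⟨s, hs, z, hz, h⟩ := exists_prepares w hw
  obtain ⟨d, hd, z', hz', h'⟩ := exists_diagonal
    (fun x : Fin n → Fin 2 => if x = (fun _ => 0) then Complex.arg ω else 0)
  refine ⟨s.inv ++ (d ++ s), ?_, z', hz', fun ψ => ?_⟩
  · simp only [List.length_append, Circuit.length_inv]; omega
  · have hD : ∀ φ : State n, d.run φ =
        z' • (φ + ((ω - 1) * φ fun _ => 0) • basisState fun _ => 0) := by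
      intro φ
      funext x
      rw [h']
      by_cases hx : x = fun _ => 0
      · subst hx
        have := Complex.norm_mul_exp_arg_mul_I ω
        rw [hω, Complex.ofReal_one, one_mul] at this
        simp only [if_true, this, basisState, Pi.smul_apply, Pi.add_apply, smul_eq_mul]
        ring
      · simp [basisState, hx]
    have h0 : s.inv.run ψ (fun _ => 0) = star z * (star w ⬝ᵥ ψ) := by
      have e1 : ∀ φ : State n, φ (fun _ => 0) = star (basisState fun _ => 0) ⬝ᵥ φ := by
        intro φ
        simp only [dotProduct, Pi.star_apply, basisState]
        rw [Finset.sum_eq_single fun _ => 0]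
        · simp
        · intro b _ hb; simp [hb]
        · simp
      rw [e1 (s.inv.run ψ), ← Circuit.star_run_dotProduct_run s, Circuit.run_run_inv, h, star_smul,
        smul_dotProduct, smul_eq_mul]
    rw [Circuit.run_append, Circuit.run_append, hD, Circuit.run_smul, Circuit.run_add,
      Circuit.run_run_inv, Circuit.run_smul, h, h0, smul_smul]
    congr 3
    have : star z * z = 1 := by
      have := Complex.conj_mul' z
      rw [hz] at this; simpa using this
    linear_combination (ω - 1) * (star w ⬝ᵥ ψ) * this

/-- A complex Householder reflection: `1 + (ω - 1) |w⟩⟨w|` maps the unit vector `u` to `v`, and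
fixes everything orthogonal to both. -/
theorem exists_householder {n : ℕ} (u v : State n) (hu : star u ⬝ᵥ u = 1) (hv : star v ⬝ᵥ v = 1) :
    ∃ (w : State n) (ω : ℂ), star w ⬝ᵥ w = 1 ∧ ‖ω‖ = 1 ∧
      u + ((ω - 1) * (star w ⬝ᵥ u)) • w = v ∧
      ∀ y, star u ⬝ᵥ y = 0 → star v ⬝ᵥ y = 0 → star w ⬝ᵥ y = 0 := by
  by_cases huv : u = v
  · exact ⟨u, 1, hu, by simp, by simp [huv], fun y h _ => h⟩
  set c := star v ⬝ᵥ u with hc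
  have hc' : star u ⬝ᵥ v = star c := by
    rw [hc, Matrix.star_dotProduct, dotProduct_comm]
  set ν : ℝ := Real.sqrt (∑ x, ‖(u - v) x‖ ^ 2) with hν
  have hpos : 0 < ∑ x, ‖(u - v) x‖ ^ 2 := by
    refine lt_of_le_of_ne (Finset.sum_nonneg fun _ _ => by positivity) fun h => huv ?_
    have := (Finset.sum_eq_zero_iff_of_nonneg fun _ _ => by positivity).1 h.symm
    funext x
    have := this x (Finset.mem_univ x)
    exact sub_eq_zero.1 (by simpa using this)
  have hνpos : 0 < ν := Real.sqrt_pos.2 hpos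
  have hν2 : (ν : ℂ) * ν = (1 - c) + (1 - star c) := by
    rw [← Complex.ofReal_mul, Real.mul_self_sqrt hpos.le, ← star_dotProduct_self]
    rw [star_sub, sub_dotProduct, dotProduct_sub, dotProduct_sub, hu, hv, hc', ← hc]
    ring
  have hν0 : (ν : ℂ) ≠ 0 := by exact_mod_cast hνpos.ne'
  have hc1 : 1 - c ≠ 0 := by
    intro h
    have h1 : c = 1 := (sub_eq_zero.1 h).symm
    rw [h1] at hν2
    simp at hν2
    exact hνpos.ne' hν2
  have hsw : ∀ y, star ((ν : ℂ)⁻¹ • (u - v)) ⬝ᵥ y = (ν : ℂ)⁻¹ * (star u ⬝ᵥ y - star v ⬝ᵥ y) := by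
    intro y
    rw [star_smul, smul_dotProduct, star_sub, sub_dotProduct]
    simp
  refine ⟨(ν : ℂ)⁻¹ • (u - v), -(1 - star c) / (1 - c), ?_, ?_, ?_, ?_⟩
  · rw [hsw, dotProduct_smul, dotProduct_smul, dotProduct_sub, dotProduct_sub, hu, hv, hc', ← hc,
      smul_eq_mul, smul_eq_mul]
    field_simp
    linear_combination -hν2
  · rw [norm_div, norm_neg]
    have : 1 - star c = star (1 - c) := by simp
    rw [this, norm_star, div_self (norm_ne_zero_iff.2 hc1)]
  · rw [hsw, hu, ← hc]
    have : (-(1 - star c) / (1 - c) - 1) * ((ν : ℂ)⁻¹ * (1 - c)) = -ν := by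
      field_simp
      linear_combination hν2
    rw [this, smul_smul]
    have : -(ν : ℂ) * (ν : ℂ)⁻¹ = -1 := by field_simp
    rw [this]
    simp
  · intro y h1 h2
    rw [hsw, h1, h2]; simp

theorem padZero_injective {m n : ℕ} (h : m ≤ n) :
    Function.Injective (padZero : (Fin m → Fin 2) → (Fin n → Fin 2)) := by
  intro α β hαβ
  funext i
  have := congrFun hαβ ⟨i, lt_of_lt_of_le i.2 h⟩
  simpa [padZero] using this

theorem star_basisState_dotProduct {n : ℕ} (x y : Fin n → Fin 2) :
    star (basisState x) ⬝ᵥ basisState y = if x = y then 1 else 0 := by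
  simp only [dotProduct, Pi.star_apply, basisState]
  rw [Finset.sum_eq_single x]
  · simp
  · intro b _ hb; simp [hb]
  · simp

/-- Given the first columns, one Householder reflection corrects the next one. -/
theorem exists_circuit_columns {m n : ℕ} (h : m ≤ n)
    (V : Matrix (Fin n → Fin 2) (Fin m → Fin 2) ℂ) (hV : Vᴴ * V = 1)
    (s : Finset (Fin m → Fin 2)) :
    ∃ c : Circuit n, c.length ≤ s.card * (15 * 2 ^ n) ∧ ∃ z : ℂ, ‖z‖ = 1 ∧
      ∀ α ∈ s, c.run (basisState (padZero α)) = z • V.col α := by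
  have hcol : ∀ α β, star (V.col α) ⬝ᵥ V.col β = if α = β then 1 else 0 := by
    intro α β
    have := congrFun (congrFun hV α) β
    rwa [Matrix.mul_apply, Matrix.one_apply] at this
  induction s using Finset.induction_on with
  | empty => exact ⟨[], by simp, 1, by simp, by simp⟩
  | insert β s hβ ih =>
    obtain ⟨c, hc, z, hz, hrun⟩ := ih
    have hzz : z * star z = 1 := by
      have := Complex.mul_conj' z
      rw [hz] at this; simpa using this
    have hz0 : star z ≠ 0 := fun h0 => by simp [h0] at hzz
    have hortho : ∀ α ∈ s, star (c.run (basisState (padZero β))) ⬝ᵥ V.col α = 0 := by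
      intro α hα
      have h1 : V.col α = star z • c.run (basisState (padZero α)) := by
        rw [hrun α hα, smul_smul, mul_comm, hzz, one_smul]
      rw [h1, dotProduct_smul, Circuit.star_run_dotProduct_run, star_basisState_dotProduct,
        if_neg, smul_zero]
      intro he
      exact hβ ((padZero_injective h he) ▸ hα)
    set u := star z • c.run (basisState (padZero β)) with hu
    obtain ⟨w, ω, hw, hω, hwu, hfix⟩ := exists_householder u (V.col β) (by
      rw [hu, star_smul, smul_dotProduct, dotProduct_smul, Circuit.star_run_dotProduct_run,
        star_basisState_dotProduct, if_pos rfl, star_star, smul_eq_mul, smul_eq_mul, mul_one, hzz])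
      (by rw [hcol, if_pos rfl])
    obtain ⟨d, hd, z', hz', hd'⟩ := exists_reflection w hw ω hω
    refine ⟨c ++ d, ?_, z * z', by simp [hz, hz'], fun α hα => ?_⟩
    · rw [List.length_append, Finset.card_insert_of_notMem hβ, add_mul, one_mul]; omega
    · rw [Circuit.run_append]
      rcases Finset.mem_insert.1 hα with rfl | hα
      · have : c.run (basisState (padZero α)) = z • u := by
          rw [hu, smul_smul, hzz, one_smul]
        rw [this, Circuit.run_smul, hd', hwu, smul_smul]
      · have : star w ⬝ᵥ V.col α = 0 := by
          refine hfix _ ?_ ?_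
          · rw [hu, star_smul, smul_dotProduct, hortho α hα, smul_zero]
          · rw [hcol, if_neg]
            rintro rfl; exact hβ hα
        rw [hrun α hα, Circuit.run_smul, hd', this]
        simp [smul_smul]

/-- Isometries from `m` to `n` qubits cost `O(2^(m+n))` gates. -/
theorem exists_isometrySynthesis : ∃ σ : IsometrySynthesis,
    ∀ (m n : ℕ) (h : m ≤ n) (V : Matrix (Fin n → Fin 2) (Fin m → Fin 2) ℂ),
      Vᴴ * V = 1 → (σ.circuit h V).length ≤ 15 * 2 ^ (m + n) := by
  have key : ∀ {m n : ℕ} (h : m ≤ n) (V : Matrix (Fin n → Fin 2) (Fin m → Fin 2) ℂ),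
      ∃ c : Circuit n, Vᴴ * V = 1 → c.length ≤ 15 * 2 ^ (m + n) ∧ ∃ z : ℂ, ‖z‖ = 1 ∧
        ∀ α x, c.run (basisState (padZero α)) x = z * V x α := by
    intro m n h V
    by_cases hV : Vᴴ * V = 1
    · obtain ⟨c, hc, z, hz, hrun⟩ := exists_circuit_columns h V hV Finset.univ
      refine ⟨c, fun _ => ⟨?_, z, hz, fun α x => ?_⟩⟩
      · simp only [Finset.card_univ, Fintype.card_fun, Fintype.card_fin] at hc
        rw [pow_add]; linarith
      · rw [hrun α (Finset.mem_univ α)]; rfl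
    · exact ⟨[], fun h => absurd h hV⟩
  choose circuit hcircuit using @key
  exact ⟨⟨@circuit, fun h V hV => (hcircuit h V hV).2⟩, fun m n h V hV => (hcircuit h V hV).1⟩

/-! ### Compact singular value decompositions -/

open scoped ComplexOrder in
/-- The columns of `V` are the eigenvectors of `Mᴴ M` with positive eigenvalue, and those of `U`
are their normalized images; `M` vanishes on the other eigenvectors. -/
theorem exists_compactSVD {ι κ : Type} [Fintype ι] [Fintype κ] (M : Matrix ι κ ℂ) :
    ∃ (r : ℕ) (U : Matrix ι (Fin r) ℂ) (s : Fin r → ℝ) (V : Matrix κ (Fin r) ℂ),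
      IsCompactSVD M U s V := by
  classical
  have hps := Matrix.posSemidef_conjTranspose_mul_self M
  set hH := hps.isHermitian
  set lam := hH.eigenvalues
  set W : Matrix κ κ ℂ := (hH.eigenvectorUnitary : Matrix κ κ ℂ)
  have hWW : Wᴴ * W = 1 := Matrix.mem_unitaryGroup_iff'.1 hH.eigenvectorUnitary.2
  have hWW' : W * Wᴴ = 1 := Matrix.mem_unitaryGroup_iff.1 hH.eigenvectorUnitary.2
  set Y := M * W with hY
  have hYY : Yᴴ * Y = Matrix.diagonal fun k => (lam k : ℂ) := by
    have := hH.conjStarAlgAut_star_eigenvectorUnitary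
    rw [Unitary.conjStarAlgAut_star_apply] at this
    rw [hY, Matrix.conjTranspose_mul, Matrix.mul_assoc, ← Matrix.mul_assoc Mᴴ]
    rw [← Matrix.mul_assoc]
    exact this
  have hYk : ∀ k l, ∑ i, star (Y i k) * Y i l = if k = l then (lam k : ℂ) else 0 := by
    intro k l
    have := congrFun (congrFun hYY k) l
    rwa [Matrix.mul_apply, Matrix.diagonal_apply] at this
  have hlam : ∀ k, 0 ≤ lam k := hps.eigenvalues_nonneg
  have hY0 : ∀ k, lam k = 0 → ∀ i, Y i k = 0 := by
    intro k hk
    have h1 : star (fun i => Y i k) ⬝ᵥ (fun i => Y i k) = 0 := by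
      have := hYk k k
      rw [hk] at this
      simpa [dotProduct] using this
    intro i
    exact congrFun (dotProduct_star_self_eq_zero.1 h1) i
  let e := (Fintype.equivFin {k // 0 < lam k}).symm
  have hs : ∀ j, 0 < Real.sqrt (lam (e j)) := fun j => Real.sqrt_pos.2 (e j).2
  have hsC : ∀ j, (Real.sqrt (lam (e j)) : ℂ) ≠ 0 := fun j => by exact_mod_cast (hs j).ne'
  refine ⟨_, Matrix.of fun i j => Y i (e j) / Real.sqrt (lam (e j)),
    fun j => Real.sqrt (lam (e j)), Matrix.of fun k j => W k (e j), ?_, ?_, hs, ?_⟩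
  · ext j l
    simp only [Matrix.mul_apply, Matrix.conjTranspose_apply, Matrix.of_apply, star_div₀,
      Matrix.one_apply]
    have : ∀ i, star (Y i (e j)) / star (Real.sqrt (lam (e j)) : ℂ) *
        (Y i (e l) / (Real.sqrt (lam (e l)) : ℂ)) = star (Y i (e j)) * Y i (e l) *
        ((Real.sqrt (lam (e j)) : ℂ)⁻¹ * (Real.sqrt (lam (e l)) : ℂ)⁻¹) := by
      intro i
      rw [show star (Real.sqrt (lam (e j)) : ℂ) = Real.sqrt (lam (e j)) from
        Complex.conj_ofReal _]
      ring
    simp only [this]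
    rw [← Finset.sum_mul, hYk]
    by_cases hjl : j = l
    · subst hjl
      rw [if_pos rfl, if_pos rfl]
      have h2 : (lam (e j) : ℂ) = Real.sqrt (lam (e j)) * Real.sqrt (lam (e j)) := by
        rw [← Complex.ofReal_mul, Real.mul_self_sqrt (hlam _)]
      rw [h2]
      have := hsC j
      field_simp
    · rw [if_neg, if_neg hjl, zero_mul]
      intro h; exact hjl (e.injective (Subtype.ext h))
  · ext j l
    have := congrFun (congrFun hWW (e j)) (e l)
    rw [Matrix.mul_apply, Matrix.one_apply] at this
    simp only [Matrix.mul_apply, Matrix.conjTranspose_apply, Matrix.of_apply, Matrix.one_apply]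
      at this ⊢
    rw [this]
    congr 1
    simp [Subtype.ext_iff.symm]
  · ext i k
    have hM : M = Y * Wᴴ := by rw [hY, Matrix.mul_assoc, hWW', Matrix.mul_one]
    rw [Matrix.mul_apply]
    simp only [Matrix.mul_diagonal, Matrix.conjTranspose_apply, Matrix.of_apply]
    have h1 : M i k = ∑ l, Y i l * star (W k l) := by
      conv_lhs => rw [hM]
      rfl
    rw [h1]
    have h2 : ∀ j, Y i (e j) / (Real.sqrt (lam (e j)) : ℂ) * (Real.sqrt (lam (e j)) : ℂ) *
        star (W k (e j)) = Y i (e j) * star (W k (e j)) := by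
      intro j; rw [div_mul_cancel₀ _ (hsC j)]
    simp only [h2]
    rw [Equiv.sum_comp e (fun l => Y i l * star (W k l))]
    rw [← Finset.sum_subtype (Finset.univ.filter fun l => 0 < lam l) (by simp)
      (fun l => Y i l * star (W k l)), Finset.sum_filter]
    refine Finset.sum_congr rfl fun l _ => ?_
    split_ifs with hl
    · rfl
    · rw [hY0 l (le_antisymm (not_lt.1 hl) (hlam l)), zero_mul]

/-- The number of singular values is at most the number of rows of `V`. -/
theorem IsCompactSVD.le_card_right {ι κ : Type} [Fintype ι] [Fintype κ] {r : ℕ}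
    {M : Matrix ι κ ℂ} {U : Matrix ι (Fin r) ℂ} {s : Fin r → ℝ} {V : Matrix κ (Fin r) ℂ}
    (h : IsCompactSVD M U s V) : r ≤ Fintype.card κ := by
  have h1 : (1 : Matrix (Fin r) (Fin r) ℂ).rank ≤ V.rank := by
    rw [← h.isometry_right]; exact Matrix.rank_mul_le_right _ _
  rw [Matrix.rank_one, Fintype.card_fin] at h1
  exact h1.trans (Matrix.rank_le_card_height V)

/-! ### The matrix product states of the automata -/

open Classical in
/-- The indicator function of a language. -/
noncomputable def indicator (T : Language (Fin 2)) (l : List (Fin 2)) : ℂ := if l ∈ T then 1 else 0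

open Classical in
theorem PDFA.bulk_eval {D : ℕ} (M : PDFA D) (n : ℕ) (x : Fin (n + 1) → Fin 2) (i : Fin D) :
    (M.bulk n).eval x i 0 =
      if ∃ q ∈ M.accept, (List.ofFn x).foldlM M.step i = some q then 1 else 0 := by
  have adj_mul : ∀ {b : ℕ} (a : Fin 2) (B : Matrix (Fin D) (Fin b) ℂ) (i : Fin D) (k : Fin b),
      (M.adj a * B) i k = (M.step i a).elim 0 fun j => B j k := by
    intro b a B i k
    rw [Matrix.mul_apply]
    simp only [PDFA.adj, Matrix.of_apply]
    cases M.step i a <;> simp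
  induction n generalizing i with
  | zero =>
    simp only [PDFA.bulk, MPS.eval, Matrix.mul_one]
    rw [adj_mul, List.ofFn_succ, List.ofFn_zero, List.foldlM_cons]
    cases h : M.step i (x 0) <;> simp [PDFA.right]
  | succ n ih =>
    simp only [PDFA.bulk, MPS.eval]
    rw [adj_mul, List.ofFn_succ, List.foldlM_cons]
    cases h : M.step i (x 0) with
    | none => simp
    | some j =>
      simp only [Option.elim_some, Option.bind_eq_bind, Option.bind_some]
      exact ih _ _

theorem PDFA.toMPS_eval {D : ℕ} (M : PDFA D) {N : ℕ} (hN : 2 ≤ N) (x : Fin N → Fin 2) :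
    (M.toMPS N).eval x 0 0 = indicator M.accepts (List.ofFn x) := by
  obtain ⟨n, rfl⟩ : ∃ n, N = n + 2 := ⟨N - 2, by omega⟩
  have h := M.bulk_eval (n + 1) x M.start
  simp only [PDFA.bulk, MPS.eval, PDFA.toMPS] at h ⊢
  rw [Matrix.mul_assoc, Matrix.mul_apply]
  simp only [PDFA.left, Matrix.of_apply, ite_mul, one_mul, zero_mul, Finset.sum_ite_eq',
    Finset.mem_univ, if_true]
  rw [h]
  have : List.ofFn x ∈ M.accepts ↔ ∃ q ∈ M.accept, (List.ofFn x).foldlM M.step M.start = some q :=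
    Iff.rfl
  simp only [indicator, this]

theorem DagDFA.toMPS_eval {N a b : ℕ} (M : DagDFA N a b) (x : Fin N → Fin 2) (i : Fin a)
    (j : Fin b) : M.toMPS.eval x i j = if M.eval i x = some j then 1 else 0 := by
  induction M with
  | nil a => simp [DagDFA.toMPS, MPS.eval, DagDFA.eval, Matrix.one_apply]
  | cons δ rest ih =>
    simp only [DagDFA.toMPS, MPS.eval, DagDFA.eval, Matrix.mul_apply, Matrix.of_apply, ih]
    obtain h | ⟨q, h⟩ : δ i (x 0) = none ∨ ∃ q, δ i (x 0) = some q := by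
      cases δ i (x 0) <;> simp
    · simp [h]
    · simp only [h]
      rw [Finset.sum_eq_single q]
      · simp
      · intro l _ hl; simp [hl.symm]
      · simp

/-- Both front ends represent the indicator function of the words of length `N`. -/
theorem FrontEnd.eval {L : Language (Fin 2)} {N : ℕ} {ρ : Route} {M : MPS N 1 1}
    (h : FrontEnd L N ρ M) (hN : 2 ≤ N) (x : Fin N → Fin 2) :
    M.eval x 0 0 = indicator L (List.ofFn x) := by
  cases h with
  | dfa M hM => rw [M.toMPS_eval hN, hM.1]
  | dag M hM =>
    rw [M.toMPS_eval]
    have : M.eval 0 x = some 0 ↔ List.ofFn x ∈ L := by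
      have := Set.ext_iff.1 hM.1 x
      exact this
    by_cases h : M.eval 0 x = some 0
    · rw [if_pos h, indicator, if_pos (this.1 h)]
    · rw [if_neg h, indicator, if_neg fun h' => h (this.2 h')]

/-- A decision procedure `S` for words, run from any of finitely many states, is realized by a
layered automaton that stores the prefix read so far. -/
theorem exists_dagDFA (N : ℕ) : ∀ (a : ℕ) (S : Fin a → (Fin (N + 1) → Fin 2) → Prop),
    ∃ M : DagDFA (N + 1) a 1, ∀ q x, M.eval q x = some 0 ↔ S q x := by
  classical
  induction N with
  | zero =>
    intro a S
    refine ⟨.cons (fun q b => if S q (fun _ => b) then some 0 else none) (.nil 1), fun q x => ?_⟩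
    have : (fun _ => x 0) = x := funext fun i => congrArg x (by omega)
    by_cases h : S q x <;> simp [DagDFA.eval, this, h]
  | succ N ih =>
    intro a S
    obtain ⟨M, hM⟩ := ih (a * 2) fun p x =>
      S (finProdFinEquiv.symm p).1 (Fin.cons (finProdFinEquiv.symm p).2 x)
    refine ⟨.cons (fun q b => some (finProdFinEquiv (q, b))) M, fun q x => ?_⟩
    simp only [DagDFA.eval, Option.bind_some]
    rw [hM]
    simp

theorem exists_frontEnd {L : Language (Fin 2)} (hL : L.IsRegular) {N : ℕ} (hN : 2 ≤ N)
    (ρ : Route) : ∃ M, FrontEnd L N ρ M := by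
  classical
  cases ρ with
  | dfa =>
    have hex : ∃ D, ∃ M : PDFA D, M.accepts = L := by
      obtain ⟨S, _, M, rfl⟩ := hL
      let e := Fintype.equivFin S
      refine ⟨Fintype.card S, ⟨fun q a => some (e (M.step (e.symm q) a)), e M.start,
        Finset.univ.filter fun q => e.symm q ∈ M.accept⟩, ?_⟩
      have key : ∀ (w : List (Fin 2)) (s : S), w.foldlM
          (fun q a => some (e (M.step (e.symm q) a))) (e s) = some (e (M.evalFrom s w)) := by
        intro w
        induction w with
        | nil => intro s; rfl
        | cons a w ih =>
          intro s
          rw [List.foldlM_cons]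
          simp only [Equiv.symm_apply_apply, Option.bind_eq_bind, Option.bind_some]
          exact ih _
      ext w
      change (∃ q ∈ _, _) ↔ M.eval w ∈ M.accept
      simp only [key]
      simp [DFA.eval]
    obtain ⟨M, hM⟩ := Nat.find_spec hex
    exact ⟨_, .dfa M ⟨hM, fun D' M' h' => Nat.find_min' hex ⟨M', h'⟩⟩⟩
  | dag =>
    obtain ⟨n, rfl⟩ : ∃ n, N = n + 1 := ⟨N - 1, by omega⟩
    have hex : ∃ k, ∃ M : DagDFA (n + 1) 1 1, M.accepts = slice L (n + 1) ∧ M.numStates = k := by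
      obtain ⟨M, hM⟩ := exists_dagDFA n 1 fun _ x => x ∈ slice L (n + 1)
      exact ⟨_, M, Set.ext fun x => hM 0 x, rfl⟩
    obtain ⟨M, hM, hk⟩ := Nat.find_spec hex
    exact ⟨_, .dag M ⟨hM, fun M' h' => hk.le.trans (Nat.find_min' hex ⟨M', h', rfl⟩)⟩⟩

/-! ### The right-to-left sweep -/

/-- All tensors of the chain are right isometries. -/
def MPS.RightIso : {N a b : ℕ} → MPS N a b → Prop
  | _, _, _, .nil _ => True
  | _, _, _, .cons A rest => ∑ x, A x * (A x)ᴴ = 1 ∧ rest.RightIso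

/-- All tensors of the chain but the first are right isometries. -/
def MPS.TailRightIso : {N a b : ℕ} → MPS N a b → Prop
  | _, _, _, .nil _ => True
  | _, _, _, .cons _ rest => rest.RightIso

/-- A chain of right isometries is a right isometry. -/
theorem MPS.RightIso.sum_eval {N a b : ℕ} {M : MPS N a b} (h : M.RightIso) :
    ∑ x, M.eval x * (M.eval x)ᴴ = 1 := by
  induction M with
  | nil a => simp [MPS.eval]
  | cons A rest ih =>
    rw [sum_cons, ← h.1]
    refine Finset.sum_congr rfl fun b _ => ?_
    simp only [MPS.eval, Fin.cons_zero, Fin.tail_cons, Matrix.conjTranspose_mul]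
    have : ∀ x, A b * rest.eval x * ((rest.eval x)ᴴ * (A b)ᴴ) =
        A b * (rest.eval x * (rest.eval x)ᴴ) * (A b)ᴴ := fun x => by
      simp only [Matrix.mul_assoc]
    simp only [this]
    rw [← Matrix.sum_mul, ← Matrix.mul_sum, ih h.2, Matrix.mul_one]

/-- The right sweep only changes the gauge; the matrix `C` remains to be absorbed. -/
theorem RightSweep.eval {N a a' b : ℕ} {M : MPS N a b} {C : Matrix (Fin a) (Fin a') ℂ}
    {M' : MPS N a' b} (h : RightSweep M C M') (x : Fin N → Fin 2) :
    M.eval x = C * M'.eval x := by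
  induction h with
  | nil a => simp [MPS.eval]
  | @cons N a m m' b r A rest C rest' U s V hrest hsvd ih =>
    simp only [MPS.eval]
    rw [ih, ← Matrix.mul_assoc, ← Matrix.mul_assoc]
    congr 1
    ext i j
    exact congrFun (congrFun hsvd.eq i) (x 0, j)

theorem RightSweep.rightIso {N a a' b : ℕ} {M : MPS N a b} {C : Matrix (Fin a) (Fin a') ℂ}
    {M' : MPS N a' b} (h : RightSweep M C M') : M'.RightIso := by
  induction h with
  | nil a => trivial
  | @cons N a m m' b r A rest C rest' U s V hrest hsvd ih =>
    refine ⟨?_, ih⟩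
    rw [← hsvd.isometry_right]
    ext k l
    simp only [Matrix.sum_apply, Matrix.mul_apply, Fintype.sum_prod_type, Matrix.of_apply,
      Matrix.conjTranspose_apply, star_star]

theorem exists_rightSweep {N a b : ℕ} (M : MPS N a b) :
    ∃ (a' : ℕ) (C : Matrix (Fin a) (Fin a') ℂ) (M' : MPS N a' b), RightSweep M C M' := by
  induction M with
  | nil a => exact ⟨_, _, _, .nil a⟩
  | cons A rest ih =>
    obtain ⟨a', C, M', h⟩ := ih
    obtain ⟨r, U, s, V, hsvd⟩ := exists_compactSVD
      (Matrix.of fun i (p : Fin 2 × Fin a') => (A p.1 * C) i p.2)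
    exact ⟨_, _, _, .cons A U s V h hsvd⟩

/-! ### The left-to-right sweep -/

theorem exists_leftSweep {N : ℕ} : ∀ {a' a : ℕ} (C : Matrix (Fin a') (Fin a) ℂ)
    (M : MPS (N + 1) a 1), ∃ M', LeftSweep C M M' := by
  induction N with
  | zero =>
    intro a' a C M
    cases M with
    | cons A rest =>
      cases rest
      exact ⟨_, .last C A⟩
  | succ N ih =>
    intro a' a C M
    cases M with
    | @cons _ _ m _ A rest =>
      obtain ⟨r, U, s, V, hsvd⟩ := exists_compactSVD
        (Matrix.of fun (p : Fin a' × Fin 2) (j : Fin m) => (C * A p.2) p.1 j)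
      obtain ⟨M', hM'⟩ := ih (Matrix.diagonal (fun k => (s k : ℂ)) * Vᴴ) rest
      exact ⟨_, .step C A U s V hsvd hM'⟩

theorem exists_seqSVD {N : ℕ} (hN : 1 ≤ N) (M : MPS N 1 1) : ∃ M', SeqSVD M M' := by
  cases M with
  | nil => omega
  | cons A rest =>
    obtain ⟨m', C, rest', hR⟩ := exists_rightSweep rest
    obtain ⟨M', hL⟩ := exists_leftSweep (1 : Matrix (Fin 1) (Fin 1) ℂ)
      (.cons (fun x => A x * C) rest')
    exact ⟨M', .mk A hR hL⟩

/-- The squared norm of a family of column vectors. -/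
noncomputable def normSq {ι : Type} [Fintype ι] {a : ℕ} (F : ι → Matrix (Fin a) (Fin 1) ℂ) : ℝ :=
  ∑ x, ∑ i, ‖F x i 0‖ ^ 2

theorem norm_sq_isometry_mul {ι : Type*} [Fintype ι] {r : ℕ} {U : Matrix ι (Fin r) ℂ}
    (hU : Uᴴ * U = 1) (v : Matrix (Fin r) (Fin 1) ℂ) :
    ∑ p, ‖(U * v) p 0‖ ^ 2 = ∑ k, ‖v k 0‖ ^ 2 := by
  have h1 := star_dotProduct_self (fun p => (U * v) p 0)
  have h2 := star_dotProduct_self (fun k => v k 0)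
  have h3 : star (fun p => (U * v) p 0) ⬝ᵥ (fun p => (U * v) p 0) = ((U * v)ᴴ * (U * v)) 0 0 := rfl
  have h4 : star (fun k => v k 0) ⬝ᵥ (fun k => v k 0) = (vᴴ * v) 0 0 := rfl
  have h5 : (U * v)ᴴ * (U * v) = vᴴ * v := by
    rw [Matrix.conjTranspose_mul, Matrix.mul_assoc, ← Matrix.mul_assoc Uᴴ, hU, Matrix.one_mul]
  rw [h3, h5, ← h4, h2] at h1
  exact_mod_cast h1.symm

/-- The left slices of the isometry of an SVD, times its remainder, give back the tensor. -/
theorem IsCompactSVD.slice_mul {a' a m r : ℕ} {C : Matrix (Fin a') (Fin a) ℂ}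
    {A : Fin 2 → Matrix (Fin a) (Fin m) ℂ} {U : Matrix (Fin a' × Fin 2) (Fin r) ℂ}
    {s : Fin r → ℝ} {V : Matrix (Fin m) (Fin r) ℂ}
    (h : IsCompactSVD (Matrix.of fun (p : Fin a' × Fin 2) j => (C * A p.2) p.1 j) U s V)
    (x : Fin 2) :
    C * A x = (Matrix.of fun i k => U (i, x) k) * (Matrix.diagonal (fun k => (s k : ℂ)) * Vᴴ) := by
  ext i j
  have := congrFun (congrFun h.eq (i, x)) j
  rw [Matrix.mul_assoc] at this
  exact this

/-- The left sweep normalizes the state. -/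
theorem LeftSweep.eval {N a' a : ℕ} {C : Matrix (Fin a') (Fin a) ℂ} {M : MPS N a 1}
    {M' : MPS N a' 1} (h : LeftSweep C M M') (x : Fin N → Fin 2) :
    M'.eval x = (((Real.sqrt (normSq fun y => C * M.eval y))⁻¹ : ℝ) : ℂ) • (C * M.eval x) := by
  induction h with
  | last C A =>
    simp only [MPS.eval, Matrix.mul_one]
    have : (normSq fun y : Fin 1 → Fin 2 => C * A (y 0)) = ∑ y, ∑ i, ‖(C * A y) i 0‖ ^ 2 := by
      rw [normSq, sum_cons]
      simp
    rw [this]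
  | @step N a' a m r C A rest rest' U s V hsvd hrest ih =>
    have key : ∀ y, C * (MPS.cons A rest).eval y = (Matrix.of fun i k => U (i, y 0) k) *
        (Matrix.diagonal (fun k => (s k : ℂ)) * Vᴴ * rest.eval (Fin.tail y)) := by
      intro y
      simp only [MPS.eval]
      rw [← Matrix.mul_assoc, hsvd.slice_mul, Matrix.mul_assoc]
    have hn : (normSq fun y => C * (MPS.cons A rest).eval y) =
        normSq fun y => Matrix.diagonal (fun k => (s k : ℂ)) * Vᴴ * rest.eval y := by
      simp only [key]
      rw [normSq, sum_cons, Finset.sum_comm]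
      refine Finset.sum_congr rfl fun y _ => ?_
      rw [← norm_sq_isometry_mul hsvd.isometry_left, Fintype.sum_prod_type, Finset.sum_comm]
      rfl
    rw [hn, key]
    simp only [MPS.eval]
    rw [ih, Matrix.mul_smul]

/-- All bond dimensions of the chain but the left-most one are at most `D`. -/
def MPS.BondsLE (D : ℕ) : {N a b : ℕ} → MPS N a b → Prop
  | _, _, _, .nil _ => True
  | _, _, _, .cons (m := m) _ rest => m ≤ D ∧ rest.BondsLE D

/-- The matrix of a function on words across the cut of `n + k` letters into `n` and `k`. -/
def cut (ψ : List (Fin 2) → ℂ) (n k : ℕ) : Matrix (Fin n → Fin 2) (Fin k → Fin 2) ℂ :=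
  Matrix.of fun a b => ψ (List.ofFn a ++ List.ofFn b)

theorem sum_snoc {n : ℕ} {M : Type*} [AddCommMonoid M] (f : (Fin (n + 1) → Fin 2) → M) :
    ∑ x, f x = ∑ b, ∑ x : Fin n → Fin 2, f (Fin.snoc x b) := by
  rw [← Fintype.sum_prod_type']
  exact (Fintype.sum_equiv (Fin.snocEquiv fun _ => Fin 2) _ _ fun p => rfl).symm

theorem ofFn_snoc_append {n k : ℕ} (x : Fin n → Fin 2) (b : Fin 2) (y : Fin k → Fin 2) :
    List.ofFn (Fin.snoc x b : Fin (n + 1) → Fin 2) ++ List.ofFn y =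
      List.ofFn x ++ List.ofFn (Fin.cons b y : Fin (k + 1) → Fin 2) := by
  rw [List.ofFn_succ', List.ofFn_succ]
  simp

/-- The bond dimensions after both sweeps are at most the Schmidt ranks: across each cut the state
is `P diag(s) Vᴴ Q` with a left isometry `P`, collected by this sweep, and a right isometry `Q`,
left by the previous one. -/
theorem LeftSweep.bondsLE {k a' a : ℕ} {C : Matrix (Fin a') (Fin a) ℂ} {M : MPS k a 1}
    {M' : MPS k a' 1} (h : LeftSweep C M M') (hM : M.TailRightIso) {n : ℕ}
    (P : (Fin n → Fin 2) → Matrix (Fin 1) (Fin a') ℂ) (hP : ∑ x, (P x)ᴴ * P x = 1)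
    (ψ : List (Fin 2) → ℂ)
    (hψ : ∀ x y, ψ (List.ofFn x ++ List.ofFn y) = (P x * (C * M.eval y)) 0 0) {D : ℕ}
    (hD1 : 1 ≤ D)
    (hD : ∀ n' k', n < n' → 0 < k' → n' + k' = n + k → (cut ψ n' k').rank ≤ D) :
    M'.BondsLE D := by
  induction h generalizing n with
  | last C A => exact ⟨hD1, trivial⟩
  | @step N a' a m r C A rest rest' U s V hsvd hrest ih =>
    let Ux : Fin 2 → Matrix (Fin a') (Fin r) ℂ := fun b => Matrix.of fun i k => U (i, b) k
    have hU : ∑ b, (Ux b)ᴴ * Ux b = 1 := by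
      rw [← hsvd.isometry_left]
      ext k l
      simp only [Ux, Matrix.sum_apply, Matrix.mul_apply, Fintype.sum_prod_type, Matrix.of_apply,
        Matrix.conjTranspose_apply]
      exact Finset.sum_comm
    let P' : (Fin (n + 1) → Fin 2) → Matrix (Fin 1) (Fin r) ℂ :=
      fun x => P (Fin.init x) * Ux (x (Fin.last n))
    have hP' : ∑ x, (P' x)ᴴ * P' x = 1 := by
      rw [sum_snoc, ← hU]
      refine Finset.sum_congr rfl fun b _ => ?_
      simp only [P', Fin.init_snoc, Fin.snoc_last, Matrix.conjTranspose_mul]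
      have : ∀ x, (Ux b)ᴴ * (P x)ᴴ * (P x * Ux b) = (Ux b)ᴴ * ((P x)ᴴ * P x) * Ux b := fun x => by
        simp only [Matrix.mul_assoc]
      simp only [this]
      rw [← Matrix.sum_mul, ← Matrix.mul_sum, hP, Matrix.mul_one]
    have hψ' : ∀ (x : Fin (n + 1) → Fin 2) y, ψ (List.ofFn x ++ List.ofFn y) =
        (P' x * (Matrix.diagonal (fun k => (s k : ℂ)) * Vᴴ * rest.eval y)) 0 0 := by
      intro x y
      have hx : x = (Fin.snoc (Fin.init x) (x (Fin.last n)) : Fin (n + 1) → Fin 2) := by simp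
      conv_lhs => rw [hx]
      rw [ofFn_snoc_append, hψ]
      simp only [MPS.eval, Fin.cons_zero, Fin.tail_cons]
      rw [← Matrix.mul_assoc C, hsvd.slice_mul]
      simp only [P', Ux, Matrix.mul_assoc]
    have hrank : r ≤ (cut ψ (n + 1) (N + 1)).rank := by
      let X : Matrix (Fin r) (Fin (n + 1) → Fin 2) ℂ := Matrix.of fun k x => star (P' x 0 k)
      let B : (Fin (N + 1) → Fin 2) → Matrix (Fin r) (Fin 1) ℂ :=
        fun y => Matrix.diagonal (fun k => (s k : ℂ)) * Vᴴ * rest.eval y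
      let B' : (Fin (N + 1) → Fin 2) → Matrix (Fin 1) (Fin r) ℂ :=
        fun y => (rest.eval y)ᴴ * V * Matrix.diagonal (fun k => (s k : ℂ)⁻¹)
      let Y : Matrix (Fin (N + 1) → Fin 2) (Fin r) ℂ := Matrix.of fun y k => B' y 0 k
      have hB : ∑ y, B y * B' y = 1 := by
        have : ∀ y, B y * B' y = Matrix.diagonal (fun k => (s k : ℂ)) * Vᴴ *
            (rest.eval y * (rest.eval y)ᴴ) * (V * Matrix.diagonal (fun k => (s k : ℂ)⁻¹)) :=
          fun y => by simp only [B, B', Matrix.mul_assoc]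
        simp only [this]
        rw [← Matrix.sum_mul, ← Matrix.mul_sum, MPS.RightIso.sum_eval hM, Matrix.mul_one,
          Matrix.mul_assoc, ← Matrix.mul_assoc Vᴴ, hsvd.isometry_right, Matrix.one_mul,
          Matrix.diagonal_mul_diagonal, ← Matrix.diagonal_one]
        congr 1
        funext k
        exact mul_inv_cancel₀ (by exact_mod_cast (hsvd.pos k).ne')
      have hX : X * (Matrix.of fun x k => P' x 0 k) = 1 := by
        rw [← hP']
        ext k l
        simp [X, Matrix.mul_apply, Matrix.sum_apply]
      have hY : (Matrix.of fun k y => B y k 0) * Y = 1 := by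
        rw [← hB]
        ext k l
        simp only [Y, Matrix.mul_apply, Matrix.sum_apply, Matrix.of_apply, Finset.univ_unique,
          Fin.default_eq_zero, Finset.sum_singleton]
      have hcut : cut ψ (n + 1) (N + 1) =
          (Matrix.of fun x k => P' x 0 k) * (Matrix.of fun k y => B y k 0) := by
        ext x y
        simp only [cut, Matrix.of_apply]
        rw [hψ']
        rfl
      have h1 : X * (cut ψ (n + 1) (N + 1) * Y) = 1 := by
        rw [hcut, Matrix.mul_assoc, hY, Matrix.mul_one, hX]
      calc r = (1 : Matrix (Fin r) (Fin r) ℂ).rank := by simp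
        _ ≤ (cut ψ (n + 1) (N + 1) * Y).rank := by rw [← h1]; exact Matrix.rank_mul_le_right _ _
        _ ≤ _ := Matrix.rank_mul_le_left _ _
    refine ⟨hrank.trans (hD _ _ (by omega) (by omega) (by omega)), ih ?_ P' hP' hψ' ?_⟩
    · cases hrest with
      | last => trivial
      | step => exact hM.2
    · exact fun n' k' h1 h2 h3 => hD n' k' (by omega) h2 (by omega)

/-! ### The canonical matrix product state -/

/-- The double sweep turns the amplitudes `ψ` into the normalized amplitudes. -/
theorem SeqSVD.eval {N : ℕ} {M M' : MPS N 1 1} (h : SeqSVD M M') (x : Fin N → Fin 2) :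
    M'.eval x 0 0 = (((Real.sqrt (∑ y, ‖M.eval y 0 0‖ ^ 2))⁻¹ : ℝ) : ℂ) * M.eval x 0 0 := by
  cases h with
  | @mk N m m' A rest C rest' M' hR hL =>
    have key : ∀ y, (1 : Matrix (Fin 1) (Fin 1) ℂ) *
        (MPS.cons (fun x => A x * C) rest').eval y = (MPS.cons A rest).eval y := by
      intro y
      simp only [MPS.eval, Matrix.one_mul]
      rw [hR.eval, Matrix.mul_assoc]
    rw [hL.eval]
    simp only [key, normSq]
    simp

theorem SeqSVD.bondsLE {N : ℕ} {M M' : MPS N 1 1} (h : SeqSVD M M') (ψ : List (Fin 2) → ℂ)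
    (hψ : ∀ x : Fin N → Fin 2, M.eval x 0 0 = ψ (List.ofFn x)) {D : ℕ} (hD1 : 1 ≤ D)
    (hD : ∀ n k, 0 < n → 0 < k → n + k = N → (cut ψ n k).rank ≤ D) : M'.BondsLE D := by
  cases h with
  | @mk N m m' A rest C rest' M' hR hL =>
    refine hL.bondsLE (n := 0) hR.rightIso (fun _ => 1) (by simp) ψ (fun x y => ?_) hD1
      (fun n' k' h1 h2 h3 => hD n' k' h1 h2 (by omega))
    rw [Matrix.one_mul, Matrix.one_mul, List.ofFn_zero, List.nil_append, ← hψ]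
    simp only [MPS.eval]
    rw [hR.eval, Matrix.mul_assoc]

/-! ### Invariants of the tree-based pass -/

namespace IsoTree

/-- The qubits at the leaves, from left to right. -/
def leaves {N : ℕ} : {d : ℕ} → IsoTree N d → List (Fin N)
  | _, .leaf q => [q]
  | _, .node l r _ => l.leaves ++ r.leaves

/-- The largest number of nodes on a path from the root to a leaf. -/
def height {N : ℕ} : {d : ℕ} → IsoTree N d → ℕ
  | _, .leaf _ => 0
  | _, .node l r _ => max l.height r.height + 1

/-- All legs of the tree have dimension at most `B`. -/
def LegsLE {N : ℕ} (B : ℕ) : {d : ℕ} → IsoTree N d → Prop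
  | _, .leaf _ => 2 ≤ B
  | d, .node l r _ => d ≤ B ∧ l.LegsLE B ∧ r.LegsLE B

theorem LegsLE.dim_le {N B d : ℕ} {t : IsoTree N d} (h : t.LegsLE B) : d ≤ B := by
  cases t with
  | leaf q => exact h
  | node l r U => exact h.1

end IsoTree

namespace TreeChain

/-- The qubits below a layer, from left to right. -/
def leaves {N : ℕ} : {a b : ℕ} → TreeChain N a b → List (Fin N)
  | _, _, .nil _ => []
  | _, _, .cons t _ rest => t.leaves ++ rest.leaves

/-- The contraction of a layer with the trees on its vertical legs. -/
noncomputable def contract {N : ℕ} :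
    {a b : ℕ} → TreeChain N a b → (Fin N → Fin 2) → Matrix (Fin a) (Fin b) ℂ
  | _, _, .nil _, _ => 1
  | _, _, .cons t A rest, x => (∑ k, t.contract x k • A k) * rest.contract x

/-- The contraction of a layer, without its trees, with its conjugate over all legs but the
left-most ones. -/
noncomputable def gram {N : ℕ} : {a b : ℕ} → TreeChain N a b → Matrix (Fin a) (Fin a) ℂ
  | _, _, .nil _ => 1
  | _, _, .cons _ A rest => ∑ k, A k * rest.gram * (A k)ᴴ

/-- All horizontal bond dimensions but the left-most one are at most `D`. -/
def BondsLE {N : ℕ} (D : ℕ) : {a b : ℕ} → TreeChain N a b → Prop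
  | _, _, .nil _ => True
  | _, _, .cons (m := m) _ _ rest => m ≤ D ∧ rest.BondsLE D

/-- All trees of a layer satisfy `p`. -/
def AllTrees {N : ℕ} (p : ∀ d, IsoTree N d → Prop) : {a b : ℕ} → TreeChain N a b → Prop
  | _, _, .nil _ => True
  | _, _, .cons t _ rest => p _ t ∧ rest.AllTrees p

theorem AllTrees.mono {N : ℕ} {p q : ∀ d, IsoTree N d → Prop} (hpq : ∀ d t, p d t → q d t)
    {a b : ℕ} {c : TreeChain N a b} (h : c.AllTrees p) : c.AllTrees q := by
  induction c with
  | nil => trivial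
  | cons t A rest ih => exact ⟨hpq _ _ h.1, ih h.2⟩

end TreeChain

/-- The remainder `diag(s) Vᴴ` of an SVD as a tensor of the next layer. -/
noncomputable def remainder {a c r : ℕ} (s : Fin r → ℝ) (V : Matrix (Fin a × Fin c) (Fin r) ℂ)
    (k : Fin r) : Matrix (Fin a) (Fin c) ℂ :=
  Matrix.of fun α γ => (s k : ℂ) * Vᴴ k (α, γ)

theorem IsCompactSVD.merge_eq {a m c d₁ d₂ r : ℕ} {A : Fin d₁ → Matrix (Fin a) (Fin m) ℂ}
    {B : Fin d₂ → Matrix (Fin m) (Fin c) ℂ} {U : Matrix (Fin d₁ × Fin d₂) (Fin r) ℂ}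
    {s : Fin r → ℝ} {V : Matrix (Fin a × Fin c) (Fin r) ℂ}
    (h : IsCompactSVD
      (Matrix.of fun (p : Fin d₁ × Fin d₂) (q : Fin a × Fin c) => (A p.1 * B p.2) q.1 q.2) U s V)
    (p : Fin d₁ × Fin d₂) : A p.1 * B p.2 = ∑ k, U p k • remainder s V k := by
  ext α γ
  have := congrFun (congrFun h.eq p) (α, γ)
  simp only [Matrix.of_apply] at this
  rw [this, Matrix.mul_apply, Matrix.sum_apply]
  refine Finset.sum_congr rfl fun k _ => ?_
  simp only [Matrix.mul_diagonal, remainder, Matrix.smul_apply, Matrix.of_apply, smul_eq_mul]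
  ring

/-- Expanding tensors in the columns of an isometry leaves the sum of their sandwiches unchanged, so
that `TreeChain.gram` is the same before and after an SVD. -/
theorem sum_isometry_sandwich {ι : Type*} [Fintype ι] {r a c : ℕ} {U : Matrix ι (Fin r) ℂ}
    (hU : Uᴴ * U = 1) (C : Fin r → Matrix (Fin a) (Fin c) ℂ) (R : Matrix (Fin c) (Fin c) ℂ) :
    ∑ p, (∑ k, U p k • C k) * R * (∑ k, U p k • C k)ᴴ = ∑ k, C k * R * (C k)ᴴ := by
  have h1 : ∀ p, (∑ k, U p k • C k) * R * (∑ k, U p k • C k)ᴴ =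
      ∑ k, ∑ l, (star (U p k) * U p l) • (C l * R * (C k)ᴴ) := by
    intro p
    rw [Matrix.conjTranspose_sum, Matrix.mul_sum]
    refine Finset.sum_congr rfl fun k _ => ?_
    rw [Matrix.sum_mul, Matrix.sum_mul]
    refine Finset.sum_congr rfl fun l _ => ?_
    rw [Matrix.conjTranspose_smul, Matrix.mul_smul, Matrix.smul_mul, Matrix.smul_mul, smul_smul]
  simp only [h1]
  rw [Finset.sum_comm]
  refine Finset.sum_congr rfl fun k _ => ?_
  rw [Finset.sum_comm]
  have h2 : ∀ l, ∑ p, (star (U p k) * U p l) • (C l * R * (C k)ᴴ) =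
      (if k = l then (1 : ℂ) else 0) • (C l * R * (C k)ᴴ) := by
    intro l
    rw [← Finset.sum_smul]
    have := congrFun (congrFun hU k) l
    rw [Matrix.mul_apply, Matrix.one_apply] at this
    rw [← this]
    rfl
  rw [Finset.sum_congr rfl fun l _ => h2 l]
  simp

namespace TreeLayer

theorem contract_eq {N a b : ℕ} {c c' : TreeChain N a b} (h : TreeLayer c c')
    (x : Fin N → Fin 2) : c'.contract x = c.contract x := by
  induction h with
  | nil a => rfl
  | unpaired t A => rfl
  | pair t₁ A t₂ B U s V hsvd hrest ih =>
    simp only [TreeChain.contract]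
    rw [ih, ← Matrix.mul_assoc]
    congr 1
    change ∑ k, (IsoTree.node t₁ t₂ U).contract x k • remainder s V k = _
    have : ∀ i j, (t₁.contract x i • A i) * (t₂.contract x j • B j) =
        ∑ k, (U (i, j) k * t₁.contract x i * t₂.contract x j) • remainder s V k := by
      intro i j
      rw [Matrix.smul_mul, Matrix.mul_smul, hsvd.merge_eq (i, j), smul_smul, Finset.smul_sum]
      refine Finset.sum_congr rfl fun k _ => ?_
      rw [smul_smul]
      congr 1
      ring
    simp only [Matrix.sum_mul, Matrix.mul_sum, this, IsoTree.contract, Finset.sum_smul]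
    conv_rhs => rw [Finset.sum_comm]
    rw [Finset.sum_comm]
    refine Finset.sum_congr rfl fun i _ => ?_
    rw [Finset.sum_comm]

theorem leaves_eq {N a b : ℕ} {c c' : TreeChain N a b} (h : TreeLayer c c') :
    c'.leaves = c.leaves := by
  induction h with
  | nil a => rfl
  | unpaired t A => rfl
  | pair t₁ A t₂ B U s V hsvd hrest ih =>
    simp [TreeChain.leaves, IsoTree.leaves, ih]

theorem gram_eq {N a b : ℕ} {c c' : TreeChain N a b} (h : TreeLayer c c') :
    c'.gram = c.gram := by
  induction h with
  | nil a => rfl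
  | unpaired t A => rfl
  | @pair a m c b d₁ d₂ r t₁ A t₂ B rest rest' U s V hsvd hrest ih =>
    simp only [TreeChain.gram]
    rw [ih]
    change ∑ k, remainder s V k * rest.gram * (remainder s V k)ᴴ = _
    rw [← sum_isometry_sandwich hsvd.isometry_left]
    simp only [← hsvd.merge_eq, Matrix.mul_sum, Matrix.sum_mul]
    rw [Fintype.sum_prod_type]
    refine Finset.sum_congr rfl fun i _ => Finset.sum_congr rfl fun j _ => ?_
    simp only [Matrix.conjTranspose_mul, Matrix.mul_assoc]

theorem length_eq {N a b : ℕ} {c c' : TreeChain N a b} (h : TreeLayer c c') :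
    c'.length = (c.length + 1) / 2 := by
  induction h with
  | nil a => simp [TreeChain.length]
  | unpaired t A => simp [TreeChain.length]
  | pair t₁ A t₂ B U s V hsvd hrest ih =>
    simp only [TreeChain.length]
    omega

theorem bondsLE {N D a b : ℕ} {c c' : TreeChain N a b} (h : TreeLayer c c')
    (hc : c.BondsLE D) : c'.BondsLE D := by
  induction h with
  | nil a => exact hc
  | unpaired t A => exact hc
  | pair t₁ A t₂ B U s V hsvd hrest ih => exact ⟨hc.2.1, ih hc.2.2⟩

theorem allTrees_isIsometric {N a b : ℕ} {c c' : TreeChain N a b} (h : TreeLayer c c')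
    (hc : c.AllTrees fun _ t => t.IsIsometric) : c'.AllTrees fun _ t => t.IsIsometric := by
  induction h with
  | nil a => exact hc
  | unpaired t A => exact hc
  | pair t₁ A t₂ B U s V hsvd hrest ih =>
    exact ⟨⟨hsvd.isometry_left, hc.1, hc.2.1⟩, ih hc.2.2⟩

theorem allTrees_height {N n a b : ℕ} {c c' : TreeChain N a b} (h : TreeLayer c c')
    (hc : c.AllTrees fun _ t => t.height ≤ n) : c'.AllTrees fun _ t => t.height ≤ n + 1 := by
  induction h with
  | nil a => exact hc
  | unpaired t A => exact hc.mono fun _ _ h => h.trans n.le_succ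
  | pair t₁ A t₂ B U s V hsvd hrest ih =>
    exact ⟨Nat.succ_le_succ (max_le hc.1 hc.2.1), ih hc.2.2⟩

/-- A vertical leg of the next layer is at most as large as the two horizontal legs of the merged
tensor together. -/
theorem allTrees_legsLE {N D B a b : ℕ} {c c' : TreeChain N a b} (h : TreeLayer c c')
    (hDB : D * D ≤ B) (ha : a ≤ D) (hc : c.BondsLE D) (hB : c.AllTrees fun _ t => t.LegsLE B) :
    c'.AllTrees fun _ t => t.LegsLE B := by
  induction h with
  | nil a => exact hB
  | unpaired t A => exact hB
  | pair t₁ A t₂ B U s V hsvd hrest ih =>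
    refine ⟨⟨?_, hB.1, hB.2.1⟩, ih hc.2.1 hc.2.2 hB.2.2⟩
    have := hsvd.le_card_right
    rw [Fintype.card_prod, Fintype.card_fin, Fintype.card_fin] at this
    exact this.trans ((Nat.mul_le_mul ha hc.2.1).trans hDB)

end TreeLayer

theorem exists_treeLayer {N : ℕ} (n : ℕ) : ∀ {a b : ℕ} (c : TreeChain N a b), c.length ≤ n →
    ∃ c', TreeLayer c c' := by
  induction n using Nat.strong_induction_on with
  | _ n ih =>
    intro a b c hc
    cases c with
    | nil => exact ⟨_, .nil _⟩
    | @cons _ m _ d₁ t₁ A rest =>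
      cases rest with
      | nil => exact ⟨_, .unpaired t₁ A⟩
      | @cons _ m' _ d₂ t₂ B rest =>
        simp only [TreeChain.length] at hc
        obtain ⟨c', hc'⟩ := ih rest.length (by omega) rest le_rfl
        obtain ⟨r, U, s, V, hsvd⟩ := exists_compactSVD (Matrix.of
          fun (p : Fin d₁ × Fin d₂) (q : Fin a × Fin m') => (A p.1 * B p.2) q.1 q.2)
        exact ⟨_, .pair t₁ A t₂ B U s V hsvd hc'⟩

theorem exists_treePass {N : ℕ} (n : ℕ) : ∀ c : TreeChain N 1 1, c.length = n → 2 ≤ n →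
    ∃ t, TreePass c t := by
  induction n using Nat.strong_induction_on with
  | _ n ih =>
    intro c hc hn
    by_cases h3 : 3 ≤ n
    · obtain ⟨c', hc'⟩ := exists_treeLayer _ c le_rfl
      obtain ⟨t, ht⟩ := ih ((n + 1) / 2) (by omega) c' (by rw [hc'.length_eq, hc]) (by omega)
      exact ⟨t, .layer (by omega) hc' ht⟩
    · cases c with
      | nil => simp only [TreeChain.length] at hc; omega
      | cons t₁ A rest =>
        cases rest with
        | nil => simp only [TreeChain.length] at hc; omega
        | cons t₂ B rest =>
          cases rest with
          | nil => exact ⟨_, .top t₁ A t₂ B⟩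
          | cons t₃ C rest => simp only [TreeChain.length] at hc; omega

namespace TreePass

theorem contract_eq {N : ℕ} {c : TreeChain N 1 1} {t : IsoTree N 1} (h : TreePass c t)
    (x : Fin N → Fin 2) : t.contract x 0 = c.contract x 0 0 := by
  induction h with
  | layer hlen hc ht ih => rw [ih, hc.contract_eq]
  | top t₁ A t₂ B =>
    simp only [IsoTree.contract, TreeChain.contract, Matrix.mul_one, Matrix.of_apply,
      Matrix.sum_mul, Matrix.mul_sum, Matrix.sum_apply, Matrix.smul_mul, Matrix.mul_smul,
      Matrix.smul_apply, smul_eq_mul]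
    simp only [Finset.mul_sum]
    conv_rhs => rw [Finset.sum_comm]
    refine Finset.sum_congr rfl fun i _ => Finset.sum_congr rfl fun j _ => ?_
    ring

theorem leaves_eq {N : ℕ} {c : TreeChain N 1 1} {t : IsoTree N 1} (h : TreePass c t) :
    t.leaves = c.leaves := by
  induction h with
  | layer hlen hc ht ih => rw [ih, hc.leaves_eq]
  | top t₁ A t₂ B => simp [IsoTree.leaves, TreeChain.leaves]

/-- The top of the tree is an isometry because the state is normalized. -/
theorem isIsometric {N : ℕ} {c : TreeChain N 1 1} {t : IsoTree N 1} (h : TreePass c t)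
    (hc : c.AllTrees fun _ t => t.IsIsometric) (hg : c.gram = 1) : t.IsIsometric := by
  induction h with
  | layer hlen hl ht ih => exact ih (hl.allTrees_isIsometric hc) (hl.gram_eq.trans hg)
  | top t₁ A t₂ B =>
    refine ⟨?_, hc.1, hc.2.1⟩
    rw [← hg]
    ext i j
    rw [Subsingleton.elim i 0, Subsingleton.elim j 0]
    simp only [TreeChain.gram, Matrix.mul_one, Matrix.mul_sum, Matrix.sum_mul]
    simp only [Matrix.sum_apply]
    rw [Matrix.mul_apply, Fintype.sum_prod_type]
    refine Finset.sum_congr rfl fun i _ => Finset.sum_congr rfl fun j _ => ?_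
    have : A i * (B j * (B j)ᴴ) * (A i)ᴴ = (A i * B j) * (A i * B j)ᴴ := by
      simp only [Matrix.conjTranspose_mul, Matrix.mul_assoc]
    rw [this, Matrix.mul_apply]
    simp [mul_comm]

theorem height_le {N : ℕ} {c : TreeChain N 1 1} {t : IsoTree N 1} (h : TreePass c t) {n : ℕ}
    (hc : c.AllTrees fun _ t => t.height ≤ n) : t.height ≤ n + Nat.clog 2 c.length := by
  induction h generalizing n with
  | layer hlen hl ht ih =>
    have := ih (hl.allTrees_height hc)
    rw [hl.length_eq] at this
    rw [Nat.clog_of_two_le (by omega) (by omega)]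
    rw [show ∀ m : ℕ, m + 2 - 1 = m + 1 from fun m => rfl]
    omega
  | top t₁ A t₂ B =>
    have h1 : max t₁.height t₂.height ≤ n := max_le hc.1 hc.2.1
    have h2 : Nat.clog 2 2 = 1 := by norm_num
    simp only [IsoTree.height, TreeChain.length, h2]
    omega

theorem legsLE {N D B : ℕ} {c : TreeChain N 1 1} {t : IsoTree N 1} (h : TreePass c t)
    (hDB : D * D ≤ B) (hD : 1 ≤ D) (hc : c.BondsLE D) (hB : c.AllTrees fun _ t => t.LegsLE B) :
    t.LegsLE B := by
  induction h with
  | layer hlen hl ht ih => exact ih (hl.bondsLE hc) (hl.allTrees_legsLE hDB hD hc hB)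
  | top t₁ A t₂ B => exact ⟨le_trans (by nlinarith) hDB, hB.1, hB.2.1⟩

end TreePass

/-! ### The initial layer -/

namespace MPS

theorem toChain_length {N n a b : ℕ} (M : MPS n a b) (f : Fin n → Fin N) :
    (M.toChain f).length = n := by
  induction M with
  | nil => rfl
  | cons A rest ih => simp [toChain, TreeChain.length, ih]

theorem toChain_leaves {N n a b : ℕ} (M : MPS n a b) (f : Fin n → Fin N) :
    (M.toChain f).leaves = List.ofFn f := by
  induction M with
  | nil => simp [toChain, TreeChain.leaves]
  | cons A rest ih =>
    rw [List.ofFn_succ]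
    simp only [toChain, TreeChain.leaves, IsoTree.leaves, ih]
    rfl

theorem toChain_contract {N n a b : ℕ} (M : MPS n a b) (f : Fin n → Fin N) (x : Fin N → Fin 2) :
    (M.toChain f).contract x = M.eval (x ∘ f) := by
  induction M with
  | nil => rfl
  | cons A rest ih =>
    simp only [toChain, TreeChain.contract, eval, ih, IsoTree.contract, ite_smul, one_smul,
      zero_smul, Finset.sum_ite_eq, Finset.mem_univ, if_true]
    rfl

theorem toChain_gram {N n a b : ℕ} (M : MPS n a b) (f : Fin n → Fin N) :
    (M.toChain f).gram = ∑ x, M.eval x * (M.eval x)ᴴ := by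
  induction M with
  | nil => simp [toChain, TreeChain.gram, eval]
  | cons A rest ih =>
    rw [sum_cons]
    simp only [toChain, TreeChain.gram, eval, ih, Fin.cons_zero, Fin.tail_cons, Matrix.mul_sum,
      Matrix.sum_mul, Matrix.conjTranspose_mul, Matrix.mul_assoc]

theorem toChain_bondsLE {N n a b D : ℕ} {M : MPS n a b} (h : M.BondsLE D) (f : Fin n → Fin N) :
    (M.toChain f).BondsLE D := by
  induction M with
  | nil => trivial
  | cons A rest ih => exact ⟨h.1, ih h.2 _⟩

theorem toChain_allTrees {N n a b : ℕ} {p : ∀ d, IsoTree N d → Prop} (hp : ∀ q, p 2 (.leaf q))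
    (M : MPS n a b) (f : Fin n → Fin N) : (M.toChain f).AllTrees p := by
  induction M with
  | nil => trivial
  | cons A rest ih => exact ⟨hp _, ih _⟩

end MPS

/-! ### Padding -/

theorem enc_injective {d : ℕ} : Function.Injective (enc : Fin d → Fin (Nat.clog 2 d) → Fin 2) := by
  intro i j h
  exact Fin.castLE_injective _ (finFunctionFinEquiv.symm.injective h)

/-- The bit string of a pair of values of the upper legs of a node. -/
def encPair {d₁ d₂ : ℕ} (p : Fin d₁ × Fin d₂) : Fin (Nat.clog 2 d₁ + Nat.clog 2 d₂) → Fin 2 :=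
  Fin.append (enc p.1) (enc p.2)

theorem encPair_injective {d₁ d₂ : ℕ} :
    Function.Injective (encPair : Fin d₁ × Fin d₂ → _) := by
  rintro ⟨i, j⟩ ⟨i', j'⟩ h
  have h1 : i = i' := enc_injective <| funext fun a => by
    simpa [encPair] using congrFun h (Fin.castAdd _ a)
  have h2 : j = j' := enc_injective <| funext fun a => by
    simpa [encPair] using congrFun h (Fin.natAdd _ a)
  rw [h1, h2]

theorem clog_le_of_isometry {d₁ d₂ d : ℕ} {U : Matrix (Fin d₁ × Fin d₂) (Fin d) ℂ}
    (hU : Uᴴ * U = 1) : Nat.clog 2 d ≤ Nat.clog 2 d₁ + Nat.clog 2 d₂ := by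
  have h1 : (1 : Matrix (Fin d) (Fin d) ℂ).rank ≤ U.rank := by
    rw [← hU]; exact Matrix.rank_mul_le_right _ _
  have h2 := Matrix.rank_le_card_height U
  rw [Matrix.rank_one, Fintype.card_fin] at h1
  rw [Fintype.card_prod, Fintype.card_fin, Fintype.card_fin] at h2
  refine Nat.clog_le_of_le_pow ((h1.trans h2).trans ?_)
  rw [pow_add]
  exact Nat.mul_le_mul (Nat.le_pow_clog one_lt_two _) (Nat.le_pow_clog one_lt_two _)

/-- Orthonormal columns, some of which are prescribed, exist as long as there are not more columns
than rows. -/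
theorem exists_isometry_extension {ι κ μ : Type} [Fintype ι] [Fintype κ] [DecidableEq κ]
    [Fintype μ] [DecidableEq μ] (hcard : Fintype.card κ ≤ Fintype.card ι) (f : μ → κ)
    (hf : Function.Injective f) (W : Matrix ι μ ℂ) (hW : Wᴴ * W = 1) :
    ∃ V : Matrix ι κ ℂ, Vᴴ * V = 1 ∧ ∀ i k, V i (f k) = W i k := by
  classical
  obtain ⟨g⟩ : Nonempty (κ ↪ ι) := Function.Embedding.nonempty_of_card_le hcard
  let v : ι → EuclideanSpace ℂ ι :=
    Function.extend (g ∘ f) (fun k => WithLp.toLp 2 fun i => W i k) 0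
  have hgf : Function.Injective (g ∘ f) := g.injective.comp hf
  have hvk : ∀ k, v ((g ∘ f) k) = WithLp.toLp 2 fun i => W i k := hgf.extend_apply _ _
  have hinner : ∀ x y : EuclideanSpace ℂ ι, inner ℂ x y = ∑ i, star (x i) * y i := by
    intro x y
    simp [EuclideanSpace.inner_eq_star_dotProduct, dotProduct, mul_comm]
  have hv : Orthonormal ℂ (Set.domRestrict (Set.range (g ∘ f)) v) := by
    rw [orthonormal_iff_ite]
    rintro ⟨_, k, rfl⟩ ⟨_, l, rfl⟩
    have hk := congrFun (congrFun hW k) l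
    rw [Matrix.mul_apply, Matrix.one_apply] at hk
    change inner ℂ (v ((g ∘ f) k)) (v ((g ∘ f) l)) = _
    rw [hvk, hvk, hinner]
    exact hk.trans (if_congr (Subtype.ext_iff.trans hgf.eq_iff).symm rfl rfl)
  obtain ⟨b, hb⟩ := hv.exists_orthonormalBasis_extension_of_card_eq (by simp)
  refine ⟨Matrix.of fun i k => b (g k) i, ?_, fun i k => ?_⟩
  · ext k l
    have := orthonormal_iff_ite.1 b.orthonormal (g k) (g l)
    rw [hinner] at this
    rw [Matrix.mul_apply, Matrix.one_apply]
    simpa [g.injective.eq_iff] using this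
  · have := hb (g (f k)) ⟨k, rfl⟩
    rw [Matrix.of_apply, this]
    exact congrArg (fun x : EuclideanSpace ℂ ι => x i) (hvk k)

theorem exists_isPadding {d₁ d₂ d : ℕ} {U : Matrix (Fin d₁ × Fin d₂) (Fin d) ℂ}
    (hU : Uᴴ * U = 1) : ∃ V, IsPadding U V := by
  classical
  -- the prescribed columns, extended by zero
  let W : Matrix (Fin (Nat.clog 2 d₁ + Nat.clog 2 d₂) → Fin 2) (Fin d) ℂ :=
    Matrix.of fun w k => Function.extend encPair (fun p => U p k) (fun _ => 0) w
  have hWp : ∀ p k, W (encPair p) k = U p k := fun p k =>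
    encPair_injective.extend_apply (fun p => U p k) (fun _ => (0 : ℂ)) p
  have hW0 : ∀ w k, w ∉ Set.range (encPair : Fin d₁ × Fin d₂ → _) → W w k = 0 :=
    fun w k hw => Function.extend_apply' (fun p => U p k) (fun _ => (0 : ℂ)) w hw
  obtain ⟨V, hV, hVW⟩ := exists_isometry_extension (κ := Fin (Nat.clog 2 d) → Fin 2) (by
      simpa using Nat.pow_le_pow_right two_pos (clog_le_of_isometry hU)) enc enc_injective W (by
      rw [← hU]
      ext k l
      simp only [Matrix.mul_apply, Matrix.conjTranspose_apply]
      rw [← Finset.sum_subset (Finset.subset_univ (Finset.univ.map ⟨encPair, encPair_injective⟩)),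
        Finset.sum_map]
      · exact Finset.sum_congr rfl fun p _ => by
          simp only [Function.Embedding.coeFn_mk, hWp]
      · intro w _ hw
        rw [hW0 w l, mul_zero]
        rintro ⟨p, rfl⟩
        exact hw (by simp))
  exact ⟨V, hV, fun i j k => (hVW _ k).trans (hWp (i, j) k)⟩

/-- The entries of a padding that are not prescribed vanish in the columns of the tensor: these
columns have norm `1` already. -/
theorem IsPadding.sum_smul {d₁ d₂ d : ℕ} {U : Matrix (Fin d₁ × Fin d₂) (Fin d) ℂ}
    {V : Matrix (Fin (Nat.clog 2 d₁ + Nat.clog 2 d₂) → Fin 2) (Fin (Nat.clog 2 d) → Fin 2) ℂ}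
    (hV : IsPadding U V) (hU : Uᴴ * U = 1) (k : Fin d) {E : Type*} [AddCommGroup E] [Module ℂ E]
    (f : (Fin (Nat.clog 2 d₁ + Nat.clog 2 d₂) → Fin 2) → E) :
    ∑ w, V w (enc k) • f w = ∑ p, U p k • f (encPair p) := by
  classical
  have hext : ∀ p, V (encPair p) (enc k) = U p k := fun p => hV.extends_tensor p.1 p.2 k
  have hn : ∀ {ι κ : Type} [Fintype ι] [Fintype κ] [DecidableEq κ] (W : Matrix ι κ ℂ),
      Wᴴ * W = 1 → ∀ l, ∑ i, ‖W i l‖ ^ 2 = 1 := by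
    intro ι κ _ _ _ W hW l
    have h1 := star_dotProduct_self (fun i => W i l)
    have h2 := congrFun (congrFun hW l) l
    rw [Matrix.one_apply_eq] at h2
    have h3 : star (fun i => W i l) ⬝ᵥ (fun i => W i l) = (Wᴴ * W) l l := rfl
    rw [h3, h2] at h1
    exact_mod_cast h1.symm
  set S : Finset (Fin (Nat.clog 2 d₁ + Nat.clog 2 d₂) → Fin 2) :=
    Finset.univ.map ⟨encPair, encPair_injective⟩ with hS
  have hsum : ∑ w ∈ S, ‖V w (enc k)‖ ^ 2 = 1 := by
    rw [hS, Finset.sum_map, ← hn U hU k]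
    exact Finset.sum_congr rfl fun p _ => by simp only [Function.Embedding.coeFn_mk, hext]
  have htot := hn V hV.isometry (enc k)
  rw [← Finset.sum_sdiff (Finset.subset_univ S), hsum] at htot
  have h0 : ∀ w ∈ Finset.univ \ S, ‖V w (enc k)‖ ^ 2 = 0 :=
    (Finset.sum_eq_zero_iff_of_nonneg fun _ _ => by positivity).1 (by linarith)
  rw [← Finset.sum_subset (Finset.subset_univ S), hS, Finset.sum_map]
  · exact Finset.sum_congr rfl fun p _ => by simp only [Function.Embedding.coeFn_mk, hext]
  · intro w _ hw
    have := h0 w (by simp [hw])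
    have : V w (enc k) = 0 := by simpa using this
    rw [this, zero_smul]

/-! ### The circuit of a tree -/

theorem IsoTree.contract_congr {N d : ℕ} (t : IsoTree N d) {x y : Fin N → Fin 2}
    (h : ∀ q ∈ t.leaves, x q = y q) (k : Fin d) : t.contract x k = t.contract y k := by
  induction t with
  | leaf q => simp only [IsoTree.contract, h q (by simp [IsoTree.leaves])]
  | node l r U ihl ihr =>
    simp only [IsoTree.contract]
    refine Finset.sum_congr rfl fun i _ => Finset.sum_congr rfl fun j _ => ?_
    rw [ihl (fun q hq => h q (by simp [IsoTree.leaves, hq])),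
      ihr (fun q hq => h q (by simp [IsoTree.leaves, hq]))]

theorem exists_treeCircuit {N d : ℕ} (σ : IsometrySynthesis) (t : IsoTree N d)
    (ht : t.IsIsometric) (hn : t.leaves.Nodup) :
    ∃ e c, TreeCircuit σ t e c ∧ ∀ i, e i ∈ t.leaves := by
  induction t with
  | leaf q =>
    have : Subsingleton (Fin (Nat.clog 2 2)) := by
      rw [show Nat.clog 2 2 = 1 by norm_num]; infer_instance
    exact ⟨⟨fun _ => q, fun i j _ => Subsingleton.elim i j⟩, [], .leaf q _ fun _ => rfl,
      fun _ => List.mem_singleton.2 rfl⟩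
  | @node d₁ d₂ d l r U ihl ihr =>
    obtain ⟨hU, hl, hr⟩ := ht
    simp only [IsoTree.leaves, List.nodup_append] at hn
    obtain ⟨hnl, hnr, hdis⟩ := hn
    obtain ⟨el, cl, hcl, hel⟩ := ihl hl hnl
    obtain ⟨er, cr, hcr, her⟩ := ihr hr hnr
    obtain ⟨V, hV⟩ := exists_isPadding hU
    have hinj : Function.Injective (Fin.append el er) := by
      intro i j
      refine Fin.addCases (fun a => ?_) (fun a => ?_) i <;>
        refine Fin.addCases (fun b => ?_) (fun b => ?_) j <;>
        simp only [Fin.append_left, Fin.append_right]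
      · intro h; rw [el.injective h]
      · intro h; exact absurd h (hdis _ (hel a) _ (her b))
      · intro h; exact absurd h.symm (hdis _ (hel b) _ (her a))
      · intro h; rw [er.injective h]
    refine ⟨_, _, .node U V hV (clog_le_of_isometry hU) ⟨Fin.append el er, hinj⟩ (by simp)
      (by simp) hcl hcr, fun i => ?_⟩
    simp only [Function.Embedding.trans_apply, Function.Embedding.coeFn_mk, IsoTree.leaves,
      List.mem_append]
    generalize (Fin.castLEEmb _) i = j
    refine Fin.addCases (fun a => ?_) (fun a => ?_) j
    · left; simpa using hel a
    · right; simpa using her a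

theorem TreeCircuit.mem_leaves {N d : ℕ} {σ : IsometrySynthesis} {t : IsoTree N d}
    {e : Fin (Nat.clog 2 d) ↪ Fin N} {c : Circuit N} (h : TreeCircuit σ t e c)
    (i : Fin (Nat.clog 2 d)) : e i ∈ t.leaves := by
  induction h with
  | leaf q e he => simp [IsoTree.leaves, he]
  | node U V hV hd e hel her hl hr ihl ihr =>
    simp only [Function.Embedding.trans_apply, IsoTree.leaves, List.mem_append]
    generalize (Fin.castLEEmb hd) i = j
    refine Fin.addCases (fun a => ?_) (fun a => ?_) j
    · left; rw [hel]; exact ihl a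
    · right; rw [her]; exact ihr a

theorem Circuit.run_eq_sum {N : ℕ} (c : Circuit N) (ψ : State N) :
    c.run ψ = ∑ x, ψ x • c.run (basisState x) := by
  have : ψ = ∑ x, ψ x • basisState x := by
    funext y
    simp [basisState, Finset.sum_apply]
  conv_lhs => rw [this]
  rw [Circuit.run_sum]
  exact Finset.sum_congr rfl fun x _ => Circuit.run_smul _ _ _

/-- An isometry compiled on the wires `e` of a basis state. -/
theorem run_map_basisState {n N : ℕ} (e : Fin n ↪ Fin N) (c : Circuit n) (y : Fin N → Fin 2) :
    Circuit.run (List.map (Gate.map e) c) (basisState y) =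
      ∑ w, c.run (basisState (y ∘ e)) w • basisState (Function.extend e w y) := by
  funext x
  rw [Circuit.run_map]
  simp only [Finset.sum_apply, Pi.smul_apply, smul_eq_mul]
  by_cases hx : Function.extend e (y ∘ e) x = y
  · have h1 : (fun w => basisState y (Function.extend e w x)) = basisState (y ∘ e) := by
      funext w
      simp only [basisState]
      congr 1
      refine propext ⟨fun h => ?_, fun h => by rw [h, hx]⟩
      rw [← h, extend_comp]
    rw [h1, Finset.sum_eq_single (x ∘ e)]
    · have : Function.extend e (x ∘ e) y = x := by
        rw [← hx, extend_extend, extend_comp_self]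
      simp [basisState, this]
    · intro w _ hw
      have : x ≠ Function.extend e w y := by
        rintro rfl
        exact hw (extend_comp e w y).symm
      simp [basisState, this]
    · simp
  · have h1 : (fun w => basisState y (Function.extend e w x)) = 0 := by
      funext w
      refine if_neg fun h => hx ?_
      rw [← h, extend_comp]
    rw [h1, Circuit.run_zero, Finset.sum_eq_zero]
    · rfl
    · intro w _
      have : x ≠ Function.extend e w y := by
        rintro rfl
        exact hx (by rw [extend_extend, extend_comp_self])
      simp [basisState, this]

theorem enc_two (k : Fin 2) (i : Fin (Nat.clog 2 2)) : enc k i = k := by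
  have h : Nat.clog 2 2 = 1 := by norm_num
  have hi : i.val = 0 := by have := i.2; omega
  ext
  simp [enc, finFunctionFinEquiv, hi]
  omega

/-- The circuit of a tree maps the value `k` of the lower leg to the contraction of the tree. -/
theorem TreeCircuit.run_basisState {N d : ℕ} {σ : IsometrySynthesis} {t : IsoTree N d}
    {e : Fin (Nat.clog 2 d) ↪ Fin N} {c : Circuit N} (h : TreeCircuit σ t e c)
    (ht : t.IsIsometric) (hn : t.leaves.Nodup) :
    ∃ z : ℂ, ‖z‖ = 1 ∧ ∀ (k : Fin d) (y : Fin N → Fin 2), y ∘ e = enc k →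
      (∀ q ∈ t.leaves, (∀ i, e i ≠ q) → y q = 0) →
      ∀ x, c.run (basisState y) x =
        if ∀ q, q ∉ t.leaves → x q = y q then z * t.contract x k else 0 := by
  induction h with
  | leaf q e he =>
    refine ⟨1, by simp, fun k y hy _ x => ?_⟩
    have hyq : y q = k := by
      have i : Fin (Nat.clog 2 2) := ⟨0, by norm_num⟩
      rw [← he i, ← enc_two k i, ← hy]
      rfl
    simp only [Circuit.run_nil, basisState, IsoTree.leaves, List.mem_singleton, IsoTree.contract,
      one_mul]
    by_cases hx : x = y
    · subst hx; simp [hyq]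
    · rw [if_neg hx]
      split_ifs with h1 h2
      · refine absurd (funext fun p => ?_) hx
        by_cases hp : p = q
        · rw [hp, h2, hyq]
        · exact h1 p hp
      · rfl
      · rfl
  | @node d₁ d₂ d l r el er cl cr U V hV hd e hel her hl hr ihl ihr =>
    obtain ⟨hU, htl, htr⟩ := ht
    simp only [IsoTree.leaves, List.nodup_append] at hn
    obtain ⟨hnl, hnr, hdis⟩ := hn
    obtain ⟨zl, hzl, runl⟩ := ihl htl hnl
    obtain ⟨zr, hzr, runr⟩ := ihr htr hnr
    obtain ⟨z, hz, hσ⟩ := σ.correct hd V hV.isometry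
    have hell := hl.mem_leaves
    have herr := hr.mem_leaves
    have hmem : ∀ i, e i ∈ l.leaves ++ r.leaves := by
      intro i
      rw [List.mem_append]
      refine Fin.addCases (fun a => ?_) (fun a => ?_) i
      · left; rw [hel]; exact hell a
      · right; rw [her]; exact herr a
    refine ⟨z * zl * zr, by simp [hz, hzl, hzr], fun k y hy hy0 x => ?_⟩
    simp only [IsoTree.leaves] at hy0
    have hye : y ∘ e = padZero (enc k) := by
      funext i
      by_cases hi : i.val < Nat.clog 2 d
      · have := congrFun hy ⟨i, hi⟩
        simp only [padZero, hi, dif_pos]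
        rw [← this]
        rfl
      · simp only [padZero, hi, dif_neg, not_false_eq_true]
        refine hy0 _ (hmem i) fun j hj => hi ?_
        have := e.injective hj
        rw [← this]
        exact j.2
    -- the first gate sequence writes the two upper legs
    have hnode : Circuit.run ((σ.circuit hd V).map (Gate.map e)) (basisState y) =
        z • ∑ p, U p k • basisState (Function.extend e (encPair p) y) := by
      rw [run_map_basisState, hye]
      simp only [hσ, ← smul_smul]
      rw [← Finset.smul_sum, hV.sum_smul hU]
    have key : ∀ p : Fin d₁ × Fin d₂,
        cr.run (cl.run (basisState (Function.extend e (encPair p) y))) x =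
        if ∀ q, q ∉ l.leaves ++ r.leaves → x q = y q then
          (zl * l.contract x p.1) * (zr * r.contract x p.2) else 0 := by
      intro p
      set yp := Function.extend e (encPair p) y with hyp
      have hype : ∀ i, yp (e i) = encPair p i := fun i => e.injective.extend_apply _ _ i
      have hypn : ∀ q, (∀ i, e i ≠ q) → yp q = y q := fun q hq =>
        Function.extend_apply' _ _ _ (by rintro ⟨i, hi⟩; exact hq i hi)
      have hl1 : yp ∘ el = enc p.1 := by
        funext a
        rw [Function.comp_apply, ← hel, hype, encPair, Fin.append_left]
      have hr1 : yp ∘ er = enc p.2 := by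
        funext a
        rw [Function.comp_apply, ← her, hype, encPair, Fin.append_right]
      have hl0 : ∀ q ∈ l.leaves, (∀ i, el i ≠ q) → yp q = 0 := by
        intro q hq hqe
        have hqe' : ∀ i, e i ≠ q := by
          intro i
          refine Fin.addCases (fun a => ?_) (fun a => ?_) i
          · rw [hel]; exact hqe a
          · rw [her]; exact (hdis q hq _ (herr a)).symm
        rw [hypn q hqe']
        exact hy0 q (List.mem_append_left _ hq) fun i => hqe' _
      have hr0 : ∀ q ∈ r.leaves, (∀ i, er i ≠ q) → yp q = 0 := by
        intro q hq hqe
        have hqe' : ∀ i, e i ≠ q := by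
          intro i
          refine Fin.addCases (fun a => ?_) (fun a => ?_) i
          · rw [hel]; exact hdis _ (hell a) q hq
          · rw [her]; exact hqe a
        rw [hypn q hqe']
        exact hy0 q (List.mem_append_right _ hq) fun i => hqe' _
      have hypy : ∀ q, q ∉ l.leaves ++ r.leaves → yp q = y q := fun q hq =>
        hypn q fun i hi => hq (hi ▸ hmem i)
      -- the only string between `yp` and `x`: that of `x` off the qubits of `r`
      let x₀ : Fin N → Fin 2 := fun q => if q ∈ r.leaves then yp q else x q
      have hx₀l : ∀ q ∈ l.leaves, x₀ q = x q := fun q hq =>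
        if_neg fun h => hdis q hq q h rfl
      rw [Circuit.run_eq_sum, Finset.sum_apply, Finset.sum_eq_single x₀]
      · rw [Pi.smul_apply, smul_eq_mul, runl p.1 yp hl1 hl0]
        have hiff : (∀ q, q ∉ l.leaves → x₀ q = yp q) ↔
            ∀ q, q ∉ l.leaves ++ r.leaves → x q = y q := by
          constructor
          · intro h q hq
            rw [← hypy q hq, ← h q fun h => hq (List.mem_append_left _ h)]
            exact (if_neg fun h => hq (List.mem_append_right _ h)).symm
          · intro h q hq
            by_cases hqr : q ∈ r.leaves
            · exact if_pos hqr
            · have hq' : q ∉ l.leaves ++ r.leaves := by simp [hq, hqr]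
              rw [hypy q hq', ← h q hq']
              exact if_neg hqr
        by_cases hx : ∀ q, q ∉ l.leaves ++ r.leaves → x q = y q
        · rw [if_pos (hiff.2 hx), if_pos hx, l.contract_congr hx₀l]
          have hagree : ∀ q ∈ r.leaves, x₀ q = yp q := fun q hq => if_pos hq
          rw [runr p.2 x₀ (by
              rw [← hr1]; funext a; exact hagree _ (herr a))
            (fun q hq hqe => by rw [hagree q hq]; exact hr0 q hq hqe), if_pos]
          intro q hq
          exact (if_neg hq).symm
        · rw [if_neg (fun h => hx (hiff.1 h)), if_neg hx, zero_mul]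
      · intro x' _ hx'
        rw [Pi.smul_apply, smul_eq_mul, runl p.1 yp hl1 hl0]
        by_cases h1 : ∀ q, q ∉ l.leaves → x' q = yp q
        · have hagree : ∀ q ∈ r.leaves, x' q = yp q := fun q hq =>
            h1 q fun h => hdis q h q hq rfl
          rw [if_pos h1, runr p.2 x' (by
              rw [← hr1]; funext a; exact hagree _ (herr a))
            (fun q hq hqe => by rw [hagree q hq]; exact hr0 q hq hqe), if_neg, mul_zero]
          intro h2
          refine hx' (funext fun q => ?_)
          by_cases hq : q ∈ r.leaves
          · rw [hagree q hq]; exact (if_pos hq).symm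
          · rw [← h2 q hq]; exact (if_neg hq).symm
        · rw [if_neg h1, zero_mul]
      · simp
    rw [Circuit.run_append, Circuit.run_append, hnode, Circuit.run_smul, Circuit.run_smul,
      Circuit.run_sum, Circuit.run_sum]
    simp only [Circuit.run_smul, Pi.smul_apply, Finset.sum_apply, key, smul_eq_mul]
    by_cases hx : ∀ q, q ∉ l.leaves ++ r.leaves → x q = y q
    · simp only [if_pos hx, IsoTree.contract]
      rw [if_pos (show ∀ q, q ∉ (l.node r U).leaves → x q = y q from hx),
        Fintype.sum_prod_type, Finset.mul_sum, Finset.mul_sum]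
      refine Finset.sum_congr rfl fun i _ => ?_
      rw [Finset.mul_sum, Finset.mul_sum]
      exact Finset.sum_congr rfl fun j _ => by ring
    · simp only [if_neg hx, mul_zero, Finset.sum_const_zero]
      exact (if_neg (show ¬∀ q, q ∉ (l.node r U).leaves → x q = y q from hx)).symm

/-! ### Gate count and depth -/

/-- The cost of a node is bounded in terms of the dimensions of its legs. -/
def SynthesisCost (σ : IsometrySynthesis) (κ : ℕ) : Prop :=
  ∀ (m n : ℕ) (h : m ≤ n) (V : Matrix (Fin n → Fin 2) (Fin m → Fin 2) ℂ),
    Vᴴ * V = 1 → (σ.circuit h V).length ≤ κ * 2 ^ (m + n)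

theorem SynthesisCost.node_le {σ : IsometrySynthesis} {κ : ℕ} (hσ : SynthesisCost σ κ)
    {B d d₁ d₂ : ℕ} (h : d ≤ B) (h₁ : d₁ ≤ B) (h₂ : d₂ ≤ B)
    (hd : Nat.clog 2 d ≤ Nat.clog 2 d₁ + Nat.clog 2 d₂)
    (V : Matrix (Fin (Nat.clog 2 d₁ + Nat.clog 2 d₂) → Fin 2) (Fin (Nat.clog 2 d) → Fin 2) ℂ)
    (hV : Vᴴ * V = 1) : (σ.circuit hd V).length ≤ κ * 2 ^ (3 * Nat.clog 2 B) := by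
  refine (hσ _ _ hd V hV).trans (Nat.mul_le_mul_left _ (Nat.pow_le_pow_right two_pos ?_))
  have := Nat.clog_mono_right 2 h
  have := Nat.clog_mono_right 2 h₁
  have := Nat.clog_mono_right 2 h₂
  omega

/-- A tree has one node less than it has leaves. -/
theorem TreeCircuit.length_le {N d : ℕ} {σ : IsometrySynthesis} {κ B : ℕ}
    (hσ : SynthesisCost σ κ) {t : IsoTree N d} {e : Fin (Nat.clog 2 d) ↪ Fin N} {c : Circuit N}
    (h : TreeCircuit σ t e c) (hB : t.LegsLE B) :
    c.length + κ * 2 ^ (3 * Nat.clog 2 B) ≤ κ * 2 ^ (3 * Nat.clog 2 B) * t.leaves.length := by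
  induction h with
  | leaf q e he => simp [IsoTree.leaves]
  | node U V hV hd e hel her hl hr ihl ihr =>
    have h1 := ihl hB.2.1
    have h2 := ihr hB.2.2
    have h3 := hσ.node_le hB.1 hB.2.1.dim_le hB.2.2.dim_le hd V hV.isometry
    simp only [List.length_append, List.length_map, IsoTree.leaves, mul_add]
    omega

/-- Each gate delays the wires of `S` by at most one time step, and does not touch the others. -/
theorem foldl_tick_le {N : ℕ} (S : Set (Fin N)) (c : Circuit N) (hc : ∀ g ∈ c, ∀ q ∈ g.wires, q ∈ S)
    (τ : Fin N → ℕ) {T : ℕ} (hT : ∀ q ∈ S, τ q ≤ T) :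
    (∀ q ∈ S, c.foldl Circuit.tick τ q ≤ T + c.length) ∧
      ∀ q, q ∉ S → c.foldl Circuit.tick τ q = τ q := by
  induction c generalizing τ T with
  | nil => exact ⟨hT, fun _ _ => rfl⟩
  | cons g c ih =>
    have hg := hc g (by simp)
    have hstep : ∀ q ∈ S, Circuit.tick τ g q ≤ T + 1 := by
      intro q hq
      unfold Circuit.tick
      split_ifs
      · exact Nat.succ_le_succ (Finset.sup_le fun p hp => hT p (hg p hp))
      · exact (hT q hq).trans T.le_succ
    have hoff : ∀ q, q ∉ S → Circuit.tick τ g q = τ q := fun q hq =>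
      if_neg fun h => hq (hg q h)
    obtain ⟨h1, h2⟩ := ih (fun g' hg' => hc g' (by simp [hg'])) (Circuit.tick τ g) hstep
    refine ⟨fun q hq => ?_, fun q hq => ?_⟩
    · have := h1 q hq
      simp only [List.foldl_cons, List.length_cons]
      omega
    · rw [List.foldl_cons, h2 q hq, hoff q hq]

theorem Gate.wires_map {n N : ℕ} (e : Fin n ↪ Fin N) (g : Gate n) :
    ∀ q ∈ (Gate.map e g).wires, ∃ i, e i = q := by
  cases g with
  | one q u => simp [Gate.map, Gate.wires]
  | cnot c t h => simp [Gate.map, Gate.wires]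

/-- The circuits of the two subtrees of a node act on different qubits, hence in parallel. -/
theorem TreeCircuit.foldl_tick_le {N d : ℕ} {σ : IsometrySynthesis} {κ B : ℕ}
    (hσ : SynthesisCost σ κ) {t : IsoTree N d} {e : Fin (Nat.clog 2 d) ↪ Fin N} {c : Circuit N}
    (h : TreeCircuit σ t e c) (hB : t.LegsLE B) (hn : t.leaves.Nodup) (τ : Fin N → ℕ) {T : ℕ}
    (hT : ∀ q ∈ t.leaves, τ q ≤ T) :
    (∀ q ∈ t.leaves, c.foldl Circuit.tick τ q ≤ T + κ * 2 ^ (3 * Nat.clog 2 B) * t.height) ∧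
      ∀ q, q ∉ t.leaves → c.foldl Circuit.tick τ q = τ q := by
  set G := κ * 2 ^ (3 * Nat.clog 2 B) with hG
  induction h generalizing τ T with
  | leaf q e he =>
    exact ⟨fun q hq => by simpa using (hT q hq).trans (Nat.le_add_right _ _), fun _ _ => rfl⟩
  | @node d₁ d₂ d l r el er cl cr U V hV hd e hel her hl hr ihl ihr =>
    simp only [IsoTree.leaves, List.nodup_append] at hn hT ⊢
    obtain ⟨hnl, hnr, hdis⟩ := hn
    have h3 := hσ.node_le hB.1 hB.2.1.dim_le hB.2.2.dim_le hd V hV.isometry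
    rw [← hG] at h3
    obtain ⟨a1, a2⟩ := TreeRLSP.foldl_tick_le {q | q ∈ l.leaves ++ r.leaves}
      ((σ.circuit hd V).map (Gate.map e)) (by
        intro g hg q hq
        obtain ⟨g', _, rfl⟩ := List.mem_map.1 hg
        obtain ⟨i, rfl⟩ := Gate.wires_map e g' q hq
        refine List.mem_append.2 (Fin.addCases (fun a => ?_) (fun a => ?_) i)
        · left; rw [hel]; exact hl.mem_leaves a
        · right; rw [her]; exact hr.mem_leaves a) τ hT
    rw [List.length_map] at a1
    rw [List.foldl_append, List.foldl_append]
    generalize List.foldl Circuit.tick τ ((σ.circuit hd V).map (Gate.map e)) = τ₁ at *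
    have a3 : ∀ q ∈ l.leaves ++ r.leaves, τ₁ q ≤ T + G := fun q hq =>
      (a1 q hq).trans (Nat.add_le_add_left h3 T)
    obtain ⟨b1, b2⟩ := ihl hB.2.1 hnl τ₁ fun q hq => a3 q (List.mem_append_left _ hq)
    generalize List.foldl Circuit.tick τ₁ cl = τ₂ at *
    obtain ⟨c1, c2⟩ := ihr hB.2.2 hnr τ₂ fun q hq => by
      rw [b2 q fun h => hdis q h q hq rfl]
      exact a3 q (List.mem_append_right _ hq)
    generalize List.foldl Circuit.tick τ₂ cr = τ₃ at *
    have hl' : G * l.height ≤ G * max l.height r.height := Nat.mul_le_mul_left _ (le_max_left _ _)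
    have hr' : G * r.height ≤ G * max l.height r.height := Nat.mul_le_mul_left _ (le_max_right _ _)
    simp only [IsoTree.height, mul_add, mul_one]
    refine ⟨fun q hq => ?_, fun q hq => ?_⟩
    · by_cases hqr : q ∈ r.leaves
      · have := c1 q hqr
        omega
      · rw [c2 q hqr]
        have := b1 q ((List.mem_append.1 hq).resolve_right hqr)
        omega
    · rw [List.mem_append, not_or] at hq
      rw [c2 q hq.2, b2 q hq.1, a2 q (by simp [hq])]

/-! ### Schmidt ranks of a language and of its complement -/

theorem rank_add_le {ι κ : Type*} [Fintype ι] [Fintype κ] (A B : Matrix ι κ ℂ) :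
    (A + B).rank ≤ A.rank + B.rank := by
  unfold Matrix.rank
  rw [Matrix.mulVecLin_add]
  refine le_trans (Submodule.finrank_mono ?_)
    (Submodule.finrank_add_le_finrank_add_finrank A.mulVecLin.range B.mulVecLin.range)
  rintro _ ⟨x, rfl⟩
  exact Submodule.add_mem_sup ⟨x, rfl⟩ ⟨x, rfl⟩

theorem rank_pos_of_ne_zero {ι κ : Type*} [Fintype ι] [Fintype κ] {A : Matrix ι κ ℂ} {i : ι}
    {j : κ} (h : A i j ≠ 0) : 0 < A.rank := by
  classical
  refine Nat.pos_of_ne_zero fun h0 => h ?_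
  have h1 : A.mulVecLin = 0 := LinearMap.range_eq_bot.1 (Submodule.finrank_eq_zero.1 h0)
  have := congrFun (LinearMap.congr_fun h1 (Pi.single j 1)) i
  simpa using this

theorem rls_eq {T : Language (Fin 2)} {N : ℕ} (x : Fin N → Fin 2) :
    rls T N x = (((Real.sqrt (slice T N).ncard)⁻¹ : ℝ) : ℂ) * indicator T (List.ofFn x) := by
  have h : x ∈ slice T N ↔ List.ofFn x ∈ T := Iff.rfl
  by_cases hx : List.ofFn x ∈ T
  · rw [rls, indicator, if_pos (h.2 hx), if_pos hx, mul_one, one_div]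
  · rw [rls, indicator, if_neg (fun h' => hx (h.1 h')), if_neg hx, mul_zero]

theorem sum_norm_indicator_sq (T : Language (Fin 2)) (N : ℕ) :
    ∑ x : Fin N → Fin 2, ‖indicator T (List.ofFn x)‖ ^ 2 = (slice T N).ncard := by
  classical
  have h : ∀ x : Fin N → Fin 2, ‖indicator T (List.ofFn x)‖ ^ 2 =
      if x ∈ slice T N then (1 : ℝ) else 0 := by
    intro x
    have h : x ∈ slice T N ↔ List.ofFn x ∈ T := Iff.rfl
    by_cases hx : List.ofFn x ∈ T
    · rw [indicator, if_pos (h.2 hx), if_pos hx]; simp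
    · rw [indicator, if_neg (fun h' => hx (h.1 h')), if_neg hx]; simp
  simp only [h]
  rw [Finset.sum_boole, Set.ncard_eq_toFinset_card' (slice T N)]
  congr 2
  ext x
  simp

theorem ncard_slice_pos {T : Language (Fin 2)} {N : ℕ} (hT : (slice T N).Nonempty) :
    (0 : ℝ) < (slice T N).ncard := by
  exact_mod_cast (Set.ncard_pos (Set.toFinite _)).2 hT

theorem sum_norm_rls_sq {T : Language (Fin 2)} {N : ℕ} (hT : (slice T N).Nonempty) :
    ∑ x, ‖rls T N x‖ ^ 2 = 1 := by
  have hpos := ncard_slice_pos hT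
  simp only [rls_eq, norm_mul, mul_pow]
  rw [← Finset.mul_sum, sum_norm_indicator_sq, Complex.norm_real, Real.norm_eq_abs, sq_abs, inv_pow,
    Real.sq_sqrt hpos.le, inv_mul_cancel₀ hpos.ne']

theorem schmidtRank_rls {L : Language (Fin 2)} {N n : ℕ} (hL : (slice L N).Nonempty)
    (hn : n ≤ N) : schmidtRank (rls L N) n = (cut (indicator L) n (N - n)).rank := by
  have hc : (((Real.sqrt (slice L N).ncard)⁻¹ : ℝ) : ℂ) ≠ 0 := by
    exact_mod_cast (inv_pos.2 (Real.sqrt_pos.2 (ncard_slice_pos hL))).ne'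
  rw [schmidtRank, ← Matrix.rank_smul_of_mem_nonZeroDivisors (cut (indicator L) n (N - n))
    (mem_nonZeroDivisors_of_ne_zero hc)]
  congr 1
  ext a b
  simp only [cutMatrix, cut, Matrix.of_apply, Matrix.smul_apply, smul_eq_mul, rls_eq]
  congr 2
  refine List.ext_getElem (by simp; omega) fun i h1 h2 => ?_
  rw [List.getElem_append]
  simp

theorem rank_cut_le {L : Language (Fin 2)} {N : ℕ} (hL : (slice L N).Nonempty) {n k : ℕ}
    (hn : 0 < n) (hk : 0 < k) (hnk : n + k = N) :
    (cut (indicator L) n k).rank ≤ maxSchmidtRank (rls L N) := by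
  obtain rfl : k = N - n := by omega
  rw [← schmidtRank_rls hL (by omega)]
  exact Finset.le_sup (f := schmidtRank (rls L N)) (Finset.mem_Icc.2 ⟨hn, by omega⟩)

theorem one_le_maxSchmidtRank {L : Language (Fin 2)} {N : ℕ} (hN : 2 ≤ N)
    (hL : (slice L N).Nonempty) : 1 ≤ maxSchmidtRank (rls L N) := by
  obtain ⟨m, rfl⟩ : ∃ m, N = 1 + (m + 1) := ⟨N - 2, by omega⟩
  refine le_trans ?_ (rank_cut_le hL (n := 1) (k := m + 1) one_pos m.succ_pos rfl)
  obtain ⟨x, hx⟩ := hL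
  refine rank_pos_of_ne_zero (i := fun i => x (Fin.castAdd (m + 1) i))
    (j := fun i => x (Fin.natAdd 1 i)) ?_
  have h : List.ofFn x ∈ L := hx
  rw [cut, Matrix.of_apply, ← List.ofFn_fin_append, Fin.append_castAdd_natAdd, indicator, if_pos h]
  exact one_ne_zero

/-- The amplitudes of the complement differ from those of the language by a sign and a constant,
that is, a matrix of rank one across each cut. -/
theorem rank_cut_compl_le (L : Language (Fin 2)) (n k : ℕ) :
    (cut (indicator Lᶜ) n k).rank ≤ (cut (indicator L) n k).rank + 1 := by
  have h : cut (indicator Lᶜ) n k = (-1 : ℂ) • cut (indicator L) n k +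
      Matrix.vecMulVec (fun _ => 1) (fun _ => 1) := by
    ext a b
    simp only [cut, Matrix.of_apply, Matrix.add_apply, Matrix.smul_apply, Matrix.vecMulVec_apply,
      smul_eq_mul]
    have h : List.ofFn a ++ List.ofFn b ∈ Lᶜ ↔ List.ofFn a ++ List.ofFn b ∉ L := Iff.rfl
    by_cases hx : List.ofFn a ++ List.ofFn b ∈ L
    · rw [indicator, indicator, if_pos hx, if_neg fun h' => h.1 h' hx]; simp
    · rw [indicator, indicator, if_neg hx, if_pos (h.2 hx)]; simp
  rw [h]
  refine (rank_add_le _ _).trans (Nat.add_le_add ?_ (Matrix.rank_vecMulVec_le _ _))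
  exact (Matrix.rank_smul_of_mem_nonZeroDivisors _ (mem_nonZeroDivisors_of_ne_zero (by simp))).le

theorem rank_cut_le_two_mul {L T : Language (Fin 2)} {N : ℕ} (hL : (slice L N).Nonempty)
    (hT : T = L ∨ T = Lᶜ) {n k : ℕ} (hn : 0 < n) (hk : 0 < k) (hnk : n + k = N) :
    (cut (indicator T) n k).rank ≤ 2 * maxSchmidtRank (rls L N) := by
  have h1 := rank_cut_le hL hn hk hnk
  have h2 := one_le_maxSchmidtRank (by omega) hL
  rcases hT with rfl | rfl
  · omega
  · have := rank_cut_compl_le L n k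
    omega

/-! ### Resources of the pipeline -/

/-- The canonical matrix product state of the pipeline evaluates to the regular language state. -/
theorem eval_eq_rls {T : Language (Fin 2)} {N : ℕ} {ρ : Route} {M M' : MPS N 1 1}
    (hN : 2 ≤ N) (hM : FrontEnd T N ρ M) (hM' : SeqSVD M M') (x : Fin N → Fin 2) :
    M'.eval x 0 0 = rls T N x := by
  rw [hM'.eval, rls_eq]
  simp only [hM.eval hN, sum_norm_indicator_sq]

theorem toChain_gram_eq_one {T : Language (Fin 2)} {N : ℕ} (hT : (slice T N).Nonempty)
    {M : MPS N 1 1} (hM : ∀ x, M.eval x 0 0 = rls T N x) (f : Fin N → Fin N) :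
    (M.toChain f).gram = 1 := by
  rw [MPS.toChain_gram]
  ext i j
  rw [Subsingleton.elim i 0, Subsingleton.elim j 0, Matrix.one_apply_eq, Matrix.sum_apply]
  have : ∀ x, (M.eval x * (M.eval x)ᴴ) 0 0 = ((‖rls T N x‖ ^ 2 : ℝ) : ℂ) := by
    intro x
    rw [Matrix.mul_apply, Fintype.sum_unique, Matrix.conjTranspose_apply]
    change M.eval x 0 0 * star (M.eval x 0 0) = _
    rw [hM]
    push_cast
    exact Complex.mul_conj' _
  simp only [this]
  rw [← Complex.ofReal_sum, sum_norm_rls_sq hT, Complex.ofReal_one]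

theorem two_pow_clog_le {B : ℕ} (hB : 1 ≤ B) : 2 ^ Nat.clog 2 B ≤ 2 * B := by
  rcases Nat.eq_or_lt_of_le hB with rfl | hB
  · simp
  · have h := Nat.pow_pred_clog_lt_self one_lt_two hB
    have h0 : Nat.clog 2 B ≠ 0 := (Nat.clog_pos one_lt_two hB).ne'
    have : 2 ^ Nat.clog 2 B = 2 * 2 ^ (Nat.clog 2 B).pred := by
      rw [← pow_succ', Nat.pred_eq_sub_one, Nat.sub_add_cancel (Nat.pos_of_ne_zero h0)]
    omega

theorem clog_le_log {N : ℕ} (hN : 2 ≤ N) : (Nat.clog 2 N : ℝ) ≤ 4 * Real.log N := by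
  have h : (2 : ℝ) ^ Nat.clog 2 N ≤ (N : ℝ) ^ 2 := by
    have h1 := two_pow_clog_le (B := N) (by omega)
    have h2 : 2 ^ Nat.clog 2 N ≤ N ^ 2 := h1.trans (by nlinarith)
    exact_mod_cast h2
  have hlog := Real.log_le_log (by positivity) h
  rw [Real.log_pow, Real.log_pow] at hlog
  have h2 : (1 : ℝ) / 2 ≤ Real.log 2 := by linarith [Real.log_two_gt_d9]
  have h3 : (0 : ℝ) ≤ Nat.clog 2 N := Nat.cast_nonneg _
  push_cast at hlog
  nlinarith

theorem exists_pipeline (σ : IsometrySynthesis) {T : Language (Fin 2)} (hreg : T.IsRegular) {N : ℕ}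
    (hN : 2 ≤ N) (hT : (slice T N).Nonempty) (ρ : Route) : ∃ t c, Pipeline σ ρ T N t c := by
  obtain ⟨M, hM⟩ := exists_frontEnd hreg hN ρ
  obtain ⟨M', hM'⟩ := exists_seqSVD (by omega) M
  obtain ⟨t, ht⟩ := exists_treePass N (M'.toChain id) (M'.toChain_length id) hN
  obtain ⟨e, c, hc, _⟩ := exists_treeCircuit σ t
    (ht.isIsometric (M'.toChain_allTrees (fun _ => trivial) id)
      (toChain_gram_eq_one hT (eval_eq_rls hN hM hM') id))
    (by rw [ht.leaves_eq, M'.toChain_leaves]; exact List.nodup_ofFn.2 Function.injective_id)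
  exact ⟨t, c, M, M', e, hM, hM', ht, hc⟩

theorem pipeline_resources {σ : IsometrySynthesis} {κ : ℕ} (hσ : SynthesisCost σ κ)
    {L T : Language (Fin 2)} {N : ℕ} (hN : 2 ≤ N) (hL : (slice L N).Nonempty)
    (hTL : T = L ∨ T = Lᶜ) (hT : (slice T N).Nonempty) {ρ : Route} {t : IsoTree N 1}
    {c : Circuit N} (h : Pipeline σ ρ T N t c) :
    t.IsIsometric ∧ (∀ x, t.contract x 0 = rls T N x) ∧ c.Prepares (rls T N) ∧
      c.depth ≤ κ * 4096 * maxSchmidtRank (rls L N) ^ 6 * Nat.clog 2 N ∧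
      c.length ≤ κ * 4096 * maxSchmidtRank (rls L N) ^ 6 * N := by
  obtain ⟨M, M', e, hM, hM', ht, hc⟩ := h
  have heval := eval_eq_rls hN hM hM'
  have hiso : t.IsIsometric := ht.isIsometric (M'.toChain_allTrees (fun _ => trivial) id)
    (toChain_gram_eq_one hT heval id)
  have hleaves : t.leaves = List.ofFn id := by rw [ht.leaves_eq, M'.toChain_leaves]
  have hnodup : t.leaves.Nodup := by rw [hleaves]; exact List.nodup_ofFn.2 Function.injective_id
  have hmem : ∀ q, q ∈ t.leaves := fun q => by rw [hleaves]; exact (List.mem_ofFn' _ _).2 ⟨q, rfl⟩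
  have hcontract : ∀ x, t.contract x 0 = rls T N x := fun x => by
    rw [ht.contract_eq, M'.toChain_contract, ← heval]; rfl
  set χ := maxSchmidtRank (rls L N) with hχ
  have hχ1 : 1 ≤ χ := one_le_maxSchmidtRank hN hL
  -- horizontal legs are bounded by `2 χ`, vertical ones by `(2 χ)²` or, at the leaves, by `2`
  have hlegs : t.LegsLE (8 * χ ^ 2) := by
    refine ht.legsLE (D := 2 * χ) (by nlinarith) (by omega)
      (MPS.toChain_bondsLE (hM'.bondsLE (indicator T) (hM.eval hN) (by omega)
        fun n k hn hk hnk => rank_cut_le_two_mul hL hTL hn hk hnk) id)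
      (M'.toChain_allTrees (fun _ => ?_) id)
    change 2 ≤ 8 * χ ^ 2
    nlinarith
  have hG : κ * 2 ^ (3 * Nat.clog 2 (8 * χ ^ 2)) ≤ κ * 4096 * χ ^ 6 := by
    rw [mul_assoc]
    refine Nat.mul_le_mul_left _ ?_
    have h1 := two_pow_clog_le (B := 8 * χ ^ 2) (by nlinarith)
    calc 2 ^ (3 * Nat.clog 2 (8 * χ ^ 2)) = (2 ^ Nat.clog 2 (8 * χ ^ 2)) ^ 3 := by
          rw [← pow_mul, mul_comm]
      _ ≤ (2 * (8 * χ ^ 2)) ^ 3 := Nat.pow_le_pow_left h1 3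
      _ = 4096 * χ ^ 6 := by ring
  refine ⟨hiso, hcontract, ?_, ?_, ?_⟩
  · obtain ⟨z, hz, hrun⟩ := hc.run_basisState hiso hnodup
    refine ⟨z, hz, funext fun x => ?_⟩
    have hclog : Nat.clog 2 1 = 0 := by norm_num
    rw [hrun 0 (fun _ => 0) (funext fun i => absurd i.2 (by omega)) (fun _ _ _ => rfl) x,
      if_pos fun q hq => absurd (hmem q) hq, hcontract]
    rfl
  · have hheight : t.height ≤ Nat.clog 2 N := by
      have := ht.height_le (n := 0) (M'.toChain_allTrees (fun _ => le_rfl) id)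
      rwa [M'.toChain_length, zero_add] at this
    refine Finset.sup_le fun q _ => ?_
    have := (hc.foldl_tick_le hσ hlegs hnodup (fun _ => 0) (T := 0) fun _ _ => le_rfl).1 q (hmem q)
    rw [zero_add] at this
    exact this.trans (Nat.mul_le_mul hG hheight)
  · have := hc.length_le hσ hlegs
    rw [hleaves, List.length_ofFn] at this
    exact (Nat.le_of_add_right_le this).trans (Nat.mul_le_mul_right N hG)

end TreeRLSP

theorem mainTheorem3 :
    ∃ σ : TreeRLSP.IsometrySynthesis,
      (∃ κ : ℝ, ∀ (m n : ℕ) (h : m ≤ n) (V : Matrix (Fin n → Fin 2) (Fin m → Fin 2) ℂ),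
        V.conjTranspose * V = 1 → ((σ.circuit h V).length : ℝ) ≤ κ * 2 ^ (m + n)) ∧
      ∃ K : ℝ, ∀ (N : ℕ), 2 ≤ N → ∀ L : Language (Fin 2), L.IsRegular →
        (TreeRLSP.slice L N).Nonempty →
        ∀ T : Language (Fin 2), (T = L ∨ T = Lᶜ) → (TreeRLSP.slice T N).Nonempty →
        ∀ ρ : TreeRLSP.Route,
          (∃ (t : TreeRLSP.IsoTree N 1) (c : TreeRLSP.Circuit N),
            TreeRLSP.Pipeline σ ρ T N t c) ∧
          ∀ (t : TreeRLSP.IsoTree N 1) (c : TreeRLSP.Circuit N),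
            TreeRLSP.Pipeline σ ρ T N t c →
              t.IsIsometric ∧
              (∀ x, t.contract x 0 = TreeRLSP.rls T N x) ∧
              c.Prepares (TreeRLSP.rls T N) ∧
              (c.depth : ℝ) ≤
                K * (TreeRLSP.maxSchmidtRank (TreeRLSP.rls L N) : ℝ) ^ 6 * Real.log N ∧
              (c.length : ℝ) ≤
                K * (TreeRLSP.maxSchmidtRank (TreeRLSP.rls L N) : ℝ) ^ 6 * N := by
  obtain ⟨σ, hσ⟩ := TreeRLSP.exists_isometrySynthesis
  -- `15` comes from the synthesis, `4096 = 16 ^ 3` from the three padded legs of a node, and `4`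
  -- from the comparison of `⌈log₂ N⌉` with the natural logarithm
  refine ⟨σ, ⟨15, fun m n h V hV => by exact_mod_cast hσ m n h V hV⟩,
    4 * (15 * 4096), fun N hN L hL hLN T hTL hTN ρ => ⟨?_, fun t c h => ?_⟩⟩
  · refine TreeRLSP.exists_pipeline σ ?_ hN hTN ρ
    rcases hTL with rfl | rfl
    · exact hL
    · exact hL.compl
  · obtain ⟨h1, h2, h3, h4, h5⟩ := TreeRLSP.pipeline_resources hσ hN hLN hTL hTN h
    refine ⟨h1, h2, h3, ?_, ?_⟩
    · have h4' : (c.depth : ℝ) ≤ 15 * 4096 *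
          (TreeRLSP.maxSchmidtRank (TreeRLSP.rls L N) : ℝ) ^ 6 * Nat.clog 2 N := by
        exact_mod_cast h4
      refine h4'.trans ?_
      have := mul_le_mul_of_nonneg_left (TreeRLSP.clog_le_log hN) (show (0 : ℝ) ≤ 15 * 4096 *
          (TreeRLSP.maxSchmidtRank (TreeRLSP.rls L N) : ℝ) ^ 6 by positivity)
      linarith
    · have h5' : (c.length : ℝ) ≤ 15 * 4096 *
          (TreeRLSP.maxSchmidtRank (TreeRLSP.rls L N) : ℝ) ^ 6 * N := by
        exact_mod_cast h5
      have h6 : (0 : ℝ) ≤ (TreeRLSP.maxSchmidtRank (TreeRLSP.rls L N) : ℝ) ^ 6 * N := by positivity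
      linarith
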